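/- Notation. $(a)_k=a(a+1)\cdots(a+k-1)$ is the Pochhammer symbol. Let $p\ge 3$, $\mathbf{x}=(x_1,\dots,x_{p-1})\in\mathbb{C}^{p-1}$, $\mathbf{y}=(y_1,\dots,y_p)\in\mathbb{C}^{p}$, $n\in\mathbb{N}_0$. For vectors $\mathbf a,\mathbf b$ put $\nu(\mathbf{a};\mathbf{b})=\sum_j b_j-\sum_i a_i$, and put $$\nu_m=\sum_{k=1}^m(y_k-x_k)\ \ (1\le m\le p-1),\qquad \psi_m=\sum_{j=1}^m y_j-\sum_{j=1}^{m-1}x_j\ \ (1\le m\le p).$$ Let $g_n^p(\mathbf{x};\mathbf{y})$ be Nørlund's coefficients, i.e. the polynomials given by $g_0^1(-;y_1)=1$, $g_n^1(-;y_1)=0$ for $n\ge1$, and, for $p\ge 2$, $$g_n^{p}(\mathbf{x};\mathbf{y})=\sum_{m=0}^{n}\frac{(y_p-x_{p-1})_{n-m}}{(n-m)!}(\nu_{p-1}+m)_{n-m}\,g_m^{p-1}\big((x_1,\dots,x_{p-2});(y_1,\dots,y_{p-1})\big).$$ For $\mathbf{l}=(l_1,\dots,l_{p-2})\in\mathbb{N}_0^{p-2}$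 let $L_m=l_1+\cdots+l_m$ for $0\le m\le p-2$ and $L_{p-1}=n$. Consider the terminating multiple series $$A_n=\frac{(\nu_{p-1})_n(y_p-x_{p-1})_n}{n!}\sum_{\mathbf{l}\in\mathbb{N}_0^{p-2}}\frac{(-n)_{L_{p-2}}}{(1-y_p+x_{p-1}-n)_{L_{p-2}}}\prod_{s=1}^{p-2}\frac{(\nu_s)_{L_s}(y_{s+1}-x_s)_{l_s}}{(\nu_{s+1})_{L_s}\,l_s!};$$ for odd $p\ge3$, $$B_n=\sum_{\mathbf{l}\in\mathbb{N}_0^{p-2}}\frac{(-n)_{L_{p-2}}(-1)^{l_2+l_4+\cdots+l_{p-3}}}{l_1!\cdots l_{p-2}!\,n!}\prod_{\substack{m=2\\ m\text{ even}}}^{p-1}\frac{(\psi_{m-1}-x_{m-1})_{L_{m-1}}(\psi_{m-1}-x_m)_{L_{m-1}}(\psi_{m+1}-y_m)_{L_m}(\psi_{m+1}-y_{m+1})_{L_m}}{(\psi_{m-1}-x_{m-1})_{L_{m-2}}(\psi_{m-1}-x_m)_{L_{m-2}}(\psi_{m+1}-y_m)_{L_{m-1}}(\psi_{m+1}-y_{m+1})_{L_{m-1}}};$$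 and for even $p\ge4$, $$B_n=\sum_{\mathbf{l}\in\mathbb{N}_0^{p-2}}\frac{(-n)_{L_{p-2}}(-1)^{l_1+l_3+\cdots+l_{p-3}}}{l_1!\cdots l_{p-2}!\,n!}(\psi_2-y_2)_{l_1}(\psi_2-y_1)_{l_1}\prod_{\substack{m=2\\ m\text{ even}}}^{p-2}\frac{(\psi_m-x_m)_{L_m}(\psi_m-x_{m+1})_{L_m}(\psi_{m+2}-y_{m+1})_{L_{m+1}}(\psi_{m+2}-y_{m+2})_{L_{m+1}}}{(\psi_m-x_m)_{L_{m-1}}(\psi_m-x_{m+1})_{L_{m-1}}(\psi_{m+2}-y_{m+1})_{L_m}(\psi_{m+2}-y_{m+2})_{L_m}}.$$ Such a series is well defined at $(\mathbf{x};\mathbf{y})$ if none of the denominators of its terms with $L_{p-2}\le n$ vanishes (the terms with $L_{p-2}>n$ are $0$). Theorem. (0) The numbers $g_n^p(\mathbf{x};\mathbf{y})$ are the coefficients of the inverse gamma series: for all complex $z$ with sufficiently large real part, $$\frac{\prod_{i=1}^{p-1}\Gamma(z+x_i)}{\prod_{j=1}^{p}\Gamma(z+y_j)}=\sum_{n=0}^\infty\frac{g_n^p(\mathbf{x};\mathbf{y})}{\Gamma(z+\nu(\mathbf{x};\mathbf{y})+n)}.$$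 (1) The series $A_n$ and $B_n$ are equal: wherever $A_n$ is well defined, $A_n=g_n^p(\mathbf{x};\mathbf{y})$, and wherever $B_n$ is well defined, $B_n=g_n^p(\mathbf{x};\mathbf{y})$. Their common value $g_n^p(\mathbf{x};\mathbf{y})$ has, for all parameters, the following properties. (2) It is unchanged under every permutation of the components of $\mathbf{x}$ and under every permutation of the components of $\mathbf{y}$. (3) For all $m\in\mathbb{N}_0$ and $\omega\in\{1,\dots,p-1\}$, with $\mathbf{x}_{[\omega]}$ denoting $\mathbf{x}$ with the component $x_\omega$ removed, $$g_{m+1}^p(\mathbf{x};\mathbf{y})=g_{m+1}^p\big((\mathbf{x}_{[\omega]},\nu(\mathbf{x};\mathbf{y})+m);\mathbf{y}\big).$$ (4) If $\nu_m$ and $y_{m+1}-x_m$ are non-negative real numbers for $m=1,\dots,p-1$, then $g_n^p(\mathbf{x};\mathbf{y})$ is real and non-negative for every $n$. -/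

import Mathlib

namespace Norlund

noncomputable section

/-- Pochhammer symbol `(a)_n = a (a + 1) ⋯ (a + n - 1)`. -/
def poch (a : ℂ) (n : ℕ) : ℂ := (ascPochhammer ℂ n).eval a

/-- `ν(a; b) = ∑ b_j - ∑ a_i`. -/
def excess {k m : ℕ} (a : Fin k → ℂ) (b : Fin m → ℂ) : ℂ := ∑ j, b j - ∑ i, a i

/-- Nørlund's coefficient `g_n^p(x; y)` with `p = q + 1`, `x ∈ ℂ^{p-1}`, `y ∈ ℂ^p`, by the
recurrence in `p` with initial values `g_0^1 = 1`, `g_n^1 = 0` for `n ≥ 1`. -/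
def coeff : (q : ℕ) → (Fin q → ℂ) → (Fin (q + 1) → ℂ) → ℕ → ℂ
  | 0, _, _, n => if n = 0 then 1 else 0
  | q + 1, x, y, n =>
      ∑ m ∈ Finset.range (n + 1),
        poch (y (Fin.last (q + 1)) - x (Fin.last q)) (n - m) / ((n - m).factorial : ℂ)
          * poch (excess x (Fin.init y) + m) (n - m)
          * coeff q (Fin.init x) (Fin.init y) m

/-- The inverse gamma series
`Γ(z + x) / Γ(z + y) = ∑ g_n / Γ(z + ν(x; y) + n)`, for all `z` with large real part. -/
def IsInverseGammaSeries {k m : ℕ} (x : Fin k → ℂ) (y : Fin m → ℂ) (g : ℕ → ℂ) : Prop :=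
  ∃ R : ℝ, ∀ z : ℂ, R < z.re →
    HasSum (fun n : ℕ => g n / Complex.Gamma (z + excess x y + n))
      ((∏ i, Complex.Gamma (z + x i)) / ∏ j, Complex.Gamma (z + y j))

/-- The component `v_i`, numbered from `1`; `0` if `i` is not an index of `v`. -/
def coord {α : Type*} [Zero α] {k : ℕ} (v : Fin k → α) (i : ℕ) : α :=
  if h : 1 ≤ i ∧ i ≤ k then v ⟨i - 1, by omega⟩ else 0

/-! Below, `p = r + 2`, `x ∈ ℂ^{p-1}`, `y ∈ ℂ^p` and `l ∈ ℕ^{p-2}`. -/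

/-- `ν_m = ∑_{k=1}^m (y_k - x_k)`. -/
def nu {r : ℕ} (x : Fin (r + 1) → ℂ) (y : Fin (r + 2) → ℂ) (m : ℕ) : ℂ :=
  ∑ k ∈ Finset.Icc 1 m, (coord y k - coord x k)

/-- `ψ_m = ∑_{j=1}^m y_j - ∑_{j=1}^{m-1} x_j`. -/
def psi {r : ℕ} (x : Fin (r + 1) → ℂ) (y : Fin (r + 2) → ℂ) (m : ℕ) : ℂ :=
  ∑ j ∈ Finset.Icc 1 m, coord y j - ∑ j ∈ Finset.Icc 1 (m - 1), coord x j

/-- `|l_m| = l_1 + ⋯ + l_m` for `m ≤ p - 2`, and `|l_{p-1}| = n` by the convention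
`l_{p-1} = n - l_1 - ⋯ - l_{p-2}`. -/
def lsum {r : ℕ} (n : ℕ) (l : Fin r → ℕ) (m : ℕ) : ℕ :=
  if m ≤ r then ∑ k ∈ Finset.Icc 1 m, coord l k else n

/-- A series `∑_l num l / den l` over `l ∈ ℕ^{p-2}` that terminates through the factor
`(-n)_{|l|}` of `num l` is well defined if no denominator with `|l| ≤ n` vanishes. -/
def WellDefined {r : ℕ} (n : ℕ) (den : (Fin r → ℕ) → ℂ) : Prop :=
  ∀ l : Fin r → ℕ, ∑ i, l i ≤ n → den l ≠ 0

/-- The value of the series `∑_l num l / den l`. -/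
def series {r : ℕ} (num den : (Fin r → ℕ) → ℂ) : ℂ := ∑' l : Fin r → ℕ, num l / den l

section first

variable {r : ℕ} (x : Fin (r + 1) → ℂ) (y : Fin (r + 2) → ℂ) (n : ℕ)

def firstNum (l : Fin r → ℕ) : ℂ :=
  poch (-(n : ℂ)) (lsum n l r)
    * ∏ s ∈ Finset.Icc 1 r,
        poch (nu x y s) (lsum n l s) * poch (coord y (s + 1) - coord x s) (coord l s)

def firstDen (l : Fin r → ℕ) : ℂ :=
  poch (1 - coord y (r + 2) + coord x (r + 1) - n) (lsum n l r)
    * ∏ s ∈ Finset.Icc 1 r,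
        poch (nu x y (s + 1)) (lsum n l s) * ((coord l s).factorial : ℂ)

/-- The first multiple hypergeometric expression (every `p ≥ 3`). -/
def firstSeries : ℂ :=
  poch (nu x y (r + 1)) n * poch (coord y (r + 2) - coord x (r + 1)) n / (n.factorial : ℂ)
    * series (firstNum x y n) (firstDen x y n)

end first

section second

variable {r : ℕ} (x : Fin (r + 1) → ℂ) (y : Fin (r + 2) → ℂ) (n : ℕ)

def oddNum (l : Fin r → ℕ) : ℂ :=
  poch (-(n : ℂ)) (lsum n l r)
    * (∏ k ∈ (Finset.Icc 2 (r - 1)).filter Even, (-1 : ℂ) ^ coord l k)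
    * ∏ m ∈ (Finset.Icc 2 (r + 1)).filter Even,
        poch (psi x y (m - 1) - coord x (m - 1)) (lsum n l (m - 1))
          * poch (psi x y (m - 1) - coord x m) (lsum n l (m - 1))
          * poch (psi x y (m + 1) - coord y m) (lsum n l m)
          * poch (psi x y (m + 1) - coord y (m + 1)) (lsum n l m)

def oddDen (l : Fin r → ℕ) : ℂ :=
  (∏ k ∈ Finset.Icc 1 r, ((coord l k).factorial : ℂ)) * (n.factorial : ℂ)
    * ∏ m ∈ (Finset.Icc 2 (r + 1)).filter Even,
        poch (psi x y (m - 1) - coord x (m - 1)) (lsum n l (m - 2))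
          * poch (psi x y (m - 1) - coord x m) (lsum n l (m - 2))
          * poch (psi x y (m + 1) - coord y m) (lsum n l (m - 1))
          * poch (psi x y (m + 1) - coord y (m + 1)) (lsum n l (m - 1))

/-- The second multiple hypergeometric expression for odd `p ≥ 3`. -/
def oddSeries : ℂ := series (oddNum x y n) (oddDen x y n)

def evenNum (l : Fin r → ℕ) : ℂ :=
  poch (-(n : ℂ)) (lsum n l r)
    * (∏ k ∈ (Finset.Icc 1 (r - 1)).filter Odd, (-1 : ℂ) ^ coord l k)
    * poch (psi x y 2 - coord y 2) (coord l 1) * poch (psi x y 2 - coord y 1) (coord l 1)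
    * ∏ m ∈ (Finset.Icc 2 r).filter Even,
        poch (psi x y m - coord x m) (lsum n l m)
          * poch (psi x y m - coord x (m + 1)) (lsum n l m)
          * poch (psi x y (m + 2) - coord y (m + 1)) (lsum n l (m + 1))
          * poch (psi x y (m + 2) - coord y (m + 2)) (lsum n l (m + 1))

def evenDen (l : Fin r → ℕ) : ℂ :=
  (∏ k ∈ Finset.Icc 1 r, ((coord l k).factorial : ℂ)) * (n.factorial : ℂ)
    * ∏ m ∈ (Finset.Icc 2 r).filter Even,
        poch (psi x y m - coord x m) (lsum n l (m - 1))
          * poch (psi x y m - coord x (m + 1)) (lsum n l (m - 1))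
          * poch (psi x y (m + 2) - coord y (m + 1)) (lsum n l m)
          * poch (psi x y (m + 2) - coord y (m + 2)) (lsum n l m)

/-- The second multiple hypergeometric expression for even `p ≥ 4`. -/
def evenSeries : ℂ := series (evenNum x y n) (evenDen x y n)

end second

end

end Norlund

namespace Norlund

open Finset Filter Topology

/-! ### Pochhammer symbols -/

/-! Unrolled, Nørlund's recurrence is a sum over chains 0 = L_0 ≤ L_1 ≤ ⋯ ≤ L_{p-1} = n of a product
of weights, one for each step L_s → L_{s+1} (`coeff_eq_chain`). With l_s = L_s - L_{s-1} such a sum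
is a sum over multi-indices (`chain_succ_eq_sum_box`), so each multiple series has to be recognised,
term by term, as a chain sum.

For A_n the weights are those of the recurrence, and the symbols in ν_s telescope. For B_n two
consecutive steps, summed over the index between them, are replaced by a step that adds two
numerator parameters followed by one that adds two denominator parameters. This exchange is a
transformation of terminating ₃F₂ series (`sum_dpoch_transform`), itself a consequence of
Chu–Vandermonde. For odd p the number of steps is even and all are paired; for even p the first step
is left alone and already has the denominator form.

The inverse gamma series follows by induction on p. Multiplication by Γ(z + x_{p-1})/Γ(z + y_p)
turns each term of the previous series into a Gauss sum, and collecting the absolutely convergent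
double series along antidiagonals gives back the recurrence. Gauss's theorem holds because the ratio
of the series to its value is unchanged under c ↦ c + 1 and tends to 1.

The coefficients are unique (`IsInverseGammaSeries.unique`) and the gamma quotient is symmetric,
hence so are they. By symmetry x_ω may be put last, where the reflection merely swaps the two
Pochhammer symbols of the last step. Non-negativity holds weight by weight. -/

@[simp] theorem poch_zero (a : ℂ) : poch a 0 = 1 := by simp [poch]

theorem poch_succ (a : ℂ) (n : ℕ) : poch a (n + 1) = poch a n * (a + n) := by
  simp [poch, ascPochhammer_succ_eval]

theorem poch_eq_prod (a : ℂ) (n : ℕ) : poch a n = ∏ i ∈ range n, (a + i) := by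
  induction n with
  | zero => simp
  | succ n ih => rw [poch_succ, prod_range_succ, ih]

theorem poch_add (a : ℂ) (m n : ℕ) : poch a (m + n) = poch a m * poch (a + m) n := by
  simp only [poch_eq_prod, prod_range_add, Nat.cast_add, add_assoc]

theorem poch_mul_poch_sub (a : ℂ) {m n : ℕ} (h : m ≤ n) :
    poch a m * poch (a + m) (n - m) = poch a n := by
  rw [← poch_add, Nat.add_sub_cancel' h]

theorem poch_reflect (a : ℂ) (n : ℕ) : poch (1 - a - n) n = (-1) ^ n * poch a n := by
  have e : ((-1 : ℂ)) ^ n = ∏ _i ∈ range n, (-1 : ℂ) := by simp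
  rw [poch_eq_prod, poch_eq_prod, ← prod_range_reflect, e, ← prod_mul_distrib]
  refine prod_congr rfl fun i hi => ?_
  have : i + 1 ≤ n := by simpa using hi
  rw [show n - 1 - i = n - (i + 1) by omega, Nat.cast_sub this]
  push_cast
  ring

theorem poch_neg_natCast_of_lt {n k : ℕ} (h : n < k) : poch (-(n : ℂ)) k = 0 :=
  ascPochhammer_eval_neg_coe_nat_of_lt h

theorem poch_neg_natCast {n k : ℕ} (h : k ≤ n) :
    poch (-(n : ℂ)) k = (-1) ^ k * (n.factorial : ℂ) / ((n - k).factorial : ℂ) := by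
  rw [eq_div_iff (by exact_mod_cast (n - k).factorial_ne_zero)]
  induction k with
  | zero => simp
  | succ k ih =>
    have ih := ih (by omega)
    rw [show n - k = n - (k + 1) + 1 by omega, Nat.factorial_succ] at ih
    push_cast [Nat.cast_sub h] at ih
    rw [poch_succ, pow_succ]
    linear_combination -ih

theorem factorial_cast_ne_zero (n : ℕ) : (n.factorial : ℂ) ≠ 0 := by
  exact_mod_cast n.factorial_ne_zero

/-- The normalised Pochhammer symbol `(a)_n / n!`. -/
noncomputable def dpoch (a : ℂ) (n : ℕ) : ℂ := poch a n / (n.factorial : ℂ)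

theorem succ_mul_dpoch_succ (a : ℂ) (n : ℕ) :
    ((n : ℂ) + 1) * dpoch a (n + 1) = (a + n) * dpoch a n := by
  have h : (n : ℂ) + 1 ≠ 0 := by exact_mod_cast n.succ_ne_zero
  have := factorial_cast_ne_zero n
  rw [dpoch, dpoch, poch_succ, Nat.factorial_succ]
  push_cast
  field_simp

/-- The Chu–Vandermonde identity. -/
theorem dpoch_add (a b : ℂ) (n : ℕ) :
    dpoch (a + b) n = ∑ ij ∈ antidiagonal n, dpoch a ij.1 * dpoch b ij.2 := by
  induction n with
  | zero => simp [dpoch]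
  | succ n ih =>
    have h : (n : ℂ) + 1 ≠ 0 := by exact_mod_cast n.succ_ne_zero
    apply mul_left_cancel₀ h
    rw [succ_mul_dpoch_succ, ih]
    -- On the antidiagonal n + 1 = i + j, so the factor is shared between the two symbols; each half
    -- loses one index by `succ_mul_dpoch_succ`, and (a + i) + (b + j) = a + b + n recombines them.
    have key : ((n : ℂ) + 1) * ∑ ij ∈ antidiagonal (n + 1), dpoch a ij.1 * dpoch b ij.2 =
        (∑ ij ∈ antidiagonal (n + 1), ((ij.1 : ℂ) * dpoch a ij.1) * dpoch b ij.2) +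
          ∑ ij ∈ antidiagonal (n + 1), dpoch a ij.1 * ((ij.2 : ℂ) * dpoch b ij.2) := by
      rw [mul_sum, ← sum_add_distrib]
      refine sum_congr rfl fun ij hij => ?_
      have : (ij.1 : ℂ) + ij.2 = n + 1 := by exact_mod_cast mem_antidiagonal.1 hij
      rw [← this]
      ring
    rw [key, Nat.sum_antidiagonal_succ, Nat.sum_antidiagonal_succ', mul_sum]
    simp only [Nat.cast_zero, zero_mul, mul_zero, zero_add, Nat.cast_add, Nat.cast_one,
      succ_mul_dpoch_succ]
    rw [← sum_add_distrib]
    refine sum_congr rfl fun ij hij => ?_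
    have : (ij.1 : ℂ) + ij.2 = n := by exact_mod_cast mem_antidiagonal.1 hij
    rw [← this]
    ring

/-- Chu–Vandermonde for b + (1 - c - n), with the left side and the second factor of each term
turned round by `poch_reflect`. -/
theorem dpoch_sub (c b : ℂ) (n : ℕ) :
    dpoch (c - b) n =
      ∑ ij ∈ antidiagonal n, (-1) ^ ij.1 * dpoch b ij.1 * dpoch (c + ij.1) ij.2 := by
  have h : dpoch (c - b) n = (-1) ^ n * dpoch (b + (1 - c - n)) n := by
    have := poch_reflect (c - b) n
    rw [show b + (1 - c - n) = 1 - (c - b) - n by ring, dpoch, dpoch, this, mul_div_assoc,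
      ← mul_assoc, ← mul_pow]
    simp
  rw [h, dpoch_add, mul_sum]
  refine sum_congr rfl fun ij hij => ?_
  have e : ij.1 + ij.2 = n := mem_antidiagonal.1 hij
  have e' : (n : ℂ) = ij.1 + ij.2 := by exact_mod_cast e.symm
  have := poch_reflect (c + ij.1) ij.2
  rw [show (1 - c - n : ℂ) = 1 - (c + ij.1) - ij.2 by rw [e']; ring, dpoch, dpoch, dpoch, this, ← e,
    pow_add]
  have h1 : ((-1 : ℂ) ^ ij.2) * (-1) ^ ij.2 = 1 := by rw [← mul_pow]; simp
  linear_combination ((-1) ^ ij.1 * (poch b ij.1 / (ij.1.factorial : ℂ)) *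
    (poch (c + ij.1) ij.2 / (ij.2.factorial : ℂ))) * h1

theorem poch_mul_eq_of_add_eq (a : ℂ) {i j n : ℕ} (h : i + j = n) :
    poch a n = poch a i * poch (a + i) j := by rw [← h, poch_add]

theorem factorial_mul_dpoch (a : ℂ) (n : ℕ) : (n.factorial : ℂ) * dpoch a n = poch a n := by
  rw [dpoch, mul_div_cancel₀ _ (factorial_cast_ne_zero n)]

/-- The equality of two terminating `₃F₂` series that underlies the symmetries of Nørlund's
coefficients. -/
theorem sum_dpoch_transform (α β γ δ : ℂ) (n : ℕ) :
    ∑ ij ∈ antidiagonal n, dpoch (γ - β) ij.1 * poch α ij.1 *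
        (dpoch (δ - α) ij.2 * poch (γ + ij.1) ij.2) =
      ∑ ij ∈ antidiagonal n, (-1) ^ ij.1 * dpoch α ij.1 * poch β ij.1 *
        (dpoch (δ + ij.1) ij.2 * poch (γ + ij.1) ij.2) := by
  -- Both sides become the same triple sum: `dpoch_sub` expands (γ - β)_i on the left, and
  -- Chu–Vandermonde for δ + i = (α + i) + (δ - α) expands the right.
  have lhs : ∀ ij ∈ antidiagonal n, dpoch (γ - β) ij.1 * poch α ij.1 *
        (dpoch (δ - α) ij.2 * poch (γ + ij.1) ij.2) =
      ∑ kl ∈ antidiagonal ij.1, (-1) ^ kl.1 * dpoch α kl.1 * poch β kl.1 *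
        (dpoch (α + kl.1) kl.2 * dpoch (δ - α) ij.2) * poch (γ + kl.1) (kl.2 + ij.2) := by
    intro ij hij
    rw [dpoch_sub, sum_mul, sum_mul]
    refine sum_congr rfl fun kl hkl => ?_
    have e : kl.1 + kl.2 = ij.1 := mem_antidiagonal.1 hkl
    rw [poch_add (γ + kl.1), poch_mul_eq_of_add_eq α e, ← e]
    simp only [dpoch]
    push_cast
    rw [add_assoc γ]
    ring
  have rhs : ∀ ij ∈ antidiagonal n, (-1) ^ ij.1 * dpoch α ij.1 * poch β ij.1 *
        (dpoch (δ + ij.1) ij.2 * poch (γ + ij.1) ij.2) =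
      ∑ kl ∈ antidiagonal ij.2, (-1) ^ ij.1 * dpoch α ij.1 * poch β ij.1 *
        (dpoch (α + ij.1) kl.1 * dpoch (δ - α) kl.2) * poch (γ + ij.1) (kl.1 + kl.2) := by
    intro ij hij
    rw [show δ + (ij.1 : ℂ) = (α + ij.1) + (δ - α) by ring, dpoch_add, sum_mul, mul_sum]
    refine sum_congr rfl fun kl hkl => ?_
    rw [mem_antidiagonal.1 hkl]
    ring
  rw [sum_congr rfl lhs, sum_congr rfl rhs, sum_sigma', sum_sigma']
  refine sum_nbij' (fun s => ⟨(s.2.1, s.2.2 + s.1.2), (s.2.2, s.1.2)⟩)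
    (fun s => ⟨(s.1.1 + s.2.1, s.2.2), (s.1.1, s.2.1)⟩) ?_ ?_ ?_ ?_ ?_
  · rintro ⟨⟨a, b⟩, ⟨c, d⟩⟩ h
    simp only [mem_sigma, HasAntidiagonal.mem_antidiagonal] at h ⊢
    grind
  · rintro ⟨⟨a, b⟩, ⟨c, d⟩⟩ h
    simp only [mem_sigma, HasAntidiagonal.mem_antidiagonal] at h ⊢
    grind
  · rintro ⟨⟨a, b⟩, ⟨c, d⟩⟩ h
    simp only [mem_sigma, HasAntidiagonal.mem_antidiagonal] at h ⊢
    rw [h.2]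
  · rintro ⟨⟨a, b⟩, ⟨c, d⟩⟩ h
    simp only [mem_sigma, HasAntidiagonal.mem_antidiagonal] at h ⊢
    rw [h.2]
  · rintro ⟨⟨a, b⟩, ⟨c, d⟩⟩ h
    rfl

/-! ### Chain sums -/

/-- The sum of `∏ w s (L_s) (L_{s+1})` over all chains `0 = L_0 ≤ L_1 ≤ ⋯ ≤ L_q = n`, defined by
recurrence in the length `q`. -/
noncomputable def chain (w : ℕ → ℕ → ℕ → ℂ) : ℕ → ℕ → ℂ
  | 0, n => if n = 0 then 1 else 0
  | q + 1, n => ∑ m ∈ range (n + 1), w q m n * chain w q m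

theorem chain_one (w : ℕ → ℕ → ℕ → ℂ) (n : ℕ) : chain w 1 n = w 0 0 n := by
  simp [chain]

theorem chain_add_two (w : ℕ → ℕ → ℕ → ℂ) (q n : ℕ) :
    chain w (q + 2) n = ∑ m ∈ range (n + 1),
      (∑ ij ∈ antidiagonal (n - m), w q m (m + ij.1) * w (q + 1) (m + ij.1) n) * chain w q m := by
  simp only [chain, sum_mul, mul_sum]
  rw [sum_sigma', sum_sigma']
  refine sum_nbij' (fun s => ⟨s.2, (s.1 - s.2, n - s.1)⟩) (fun s => ⟨s.1 + s.2.1, s.1⟩) ?_ ?_ ?_ ?_ ?_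
  · rintro ⟨a, b⟩ h
    simp only [mem_sigma, mem_range, HasAntidiagonal.mem_antidiagonal] at h ⊢
    omega
  · rintro ⟨a, ⟨b, c⟩⟩ h
    simp only [mem_sigma, mem_range, HasAntidiagonal.mem_antidiagonal] at h ⊢
    omega
  · rintro ⟨a, b⟩ h
    simp only [mem_sigma, mem_range] at h ⊢
    rw [Nat.add_sub_cancel' (by omega)]
  · rintro ⟨a, ⟨b, c⟩⟩ h
    simp only [mem_sigma, mem_range, HasAntidiagonal.mem_antidiagonal] at h ⊢
    rw [Nat.add_sub_cancel_left, show n - (a + b) = c by omega]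
  · rintro ⟨a, b⟩ h
    simp only [mem_sigma, mem_range] at h ⊢
    rw [Nat.add_sub_cancel' (by omega)]
    ring

/-- The last two weights need to agree only after summation over the index between them; this is
what allows steps to be exchanged in pairs. -/
theorem chain_add_two_congr {w v : ℕ → ℕ → ℕ → ℂ} {q : ℕ}
    (h : ∀ m n, m ≤ n →
      ∑ ij ∈ antidiagonal (n - m), w q m (m + ij.1) * w (q + 1) (m + ij.1) n =
        ∑ ij ∈ antidiagonal (n - m), v q m (m + ij.1) * v (q + 1) (m + ij.1) n)
    (hq : ∀ m, chain w q m = chain v q m) (n : ℕ) : chain w (q + 2) n = chain v (q + 2) n := by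
  rw [chain_add_two, chain_add_two]
  refine sum_congr rfl fun m hm => ?_
  rw [h m n (by simpa [Nat.lt_succ_iff] using hm), hq]

/-- The multi-indices `l ∈ ℕ^r` with `|l| ≤ n`. -/
def box (r n : ℕ) : Finset (Fin r → ℕ) :=
  (Fintype.piFinset fun _ => range (n + 1)).filter fun l => ∑ i, l i ≤ n

theorem mem_box {r n : ℕ} {l : Fin r → ℕ} : l ∈ box r n ↔ ∑ i, l i ≤ n := by
  simp only [box, mem_filter, Fintype.mem_piFinset, mem_range, and_iff_right_iff_imp]
  intro h i
  have := single_le_sum (f := l) (fun _ _ => Nat.zero_le _) (mem_univ i)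
  omega

/-! ### Coordinates and partial sums of multi-indices -/

theorem coord_succ {α : Type*} [Zero α] {k : ℕ} (v : Fin k → α) (i : Fin k) :
    coord v (i + 1) = v i := by
  have := i.2
  simp [coord]

theorem sum_coord {M : Type*} [AddCommMonoid M] {k : ℕ} (v : Fin k → M) :
    ∑ i ∈ Icc 1 k, coord v i = ∑ i, v i := by
  rw [← Ico_add_one_right_eq_Icc, sum_Ico_eq_sum_range, Nat.add_sub_cancel, ← Fin.sum_univ_eq_sum_range
    (fun i => coord v (1 + i))]
  simp [add_comm 1, coord_succ]

theorem coord_snoc_of_le {α : Type*} [Zero α] {k : ℕ} (v : Fin k → α) (a : α) {i : ℕ} (h : i ≤ k) :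
    coord (Fin.snoc v a : Fin (k + 1) → α) i = coord v i := by
  unfold coord
  by_cases h1 : 1 ≤ i
  · rw [dif_pos ⟨h1, by omega⟩, dif_pos ⟨h1, h⟩]
    exact Fin.snoc_castSucc (α := fun _ => α) a v ⟨i - 1, by omega⟩
  · rw [dif_neg (by omega), dif_neg (by omega)]

theorem lsum_of_le {r : ℕ} (n : ℕ) (l : Fin r → ℕ) {m : ℕ} (h : m ≤ r) :
    lsum n l m = ∑ k ∈ Icc 1 m, coord l k := if_pos h

@[simp] theorem lsum_zero {r : ℕ} (n : ℕ) (l : Fin r → ℕ) : lsum n l 0 = 0 := by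
  simp [lsum_of_le]

theorem lsum_self {r : ℕ} (n : ℕ) (l : Fin r → ℕ) : lsum n l r = ∑ i, l i := by
  rw [lsum_of_le _ _ le_rfl, sum_coord]

@[simp] theorem lsum_succ_self {r : ℕ} (n : ℕ) (l : Fin r → ℕ) : lsum n l (r + 1) = n :=
  if_neg (by omega)

theorem lsum_succ {r : ℕ} (n : ℕ) (l : Fin r → ℕ) {m : ℕ} (h : m < r) :
    lsum n l (m + 1) = lsum n l m + coord l (m + 1) := by
  rw [lsum_of_le _ _ h.le, lsum_of_le _ _ h, sum_Icc_succ_top (by omega)]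

theorem lsum_le_succ {r : ℕ} {n : ℕ} {l : Fin r → ℕ} (hl : ∑ i, l i ≤ n) {m : ℕ} (h : m ≤ r) :
    lsum n l m ≤ lsum n l (m + 1) := by
  rcases h.lt_or_eq with h | rfl
  · rw [lsum_succ _ _ h]
    omega
  · rw [lsum_self, lsum_succ_self]
    exact hl

theorem lsum_le {r : ℕ} {n : ℕ} {l : Fin r → ℕ} (hl : ∑ i, l i ≤ n) (m : ℕ) :
    lsum n l m ≤ n := by
  by_cases h : m ≤ r
  · refine le_trans ?_ hl
    rw [lsum_of_le _ _ h, ← sum_coord]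
    exact sum_le_sum_of_subset (Icc_subset_Icc_right h)
  · rw [lsum, if_neg h]

/-- The appended component m - |l| makes the partial sum at r + 1 equal to m, which is the value
that the convention assigns to l alone with endpoint m. This is the inductive step from chains to
multi-indices. -/
theorem lsum_snoc {r : ℕ} (n : ℕ) (l : Fin r → ℕ) {m : ℕ} (hl : ∑ i, l i ≤ m) {s : ℕ}
    (h : s ≤ r + 1) :
    lsum n (Fin.snoc l (m - ∑ i, l i) : Fin (r + 1) → ℕ) s = lsum m l s := by
  rcases Nat.lt_succ_iff_lt_or_eq.1 (Nat.lt_succ_of_le h) with h' | rfl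
  · rw [lsum_of_le _ _ h, lsum_of_le _ _ (by omega)]
    refine sum_congr rfl fun k hk => coord_snoc_of_le _ _ ?_
    have := (mem_Icc.1 hk).2
    omega
  · rw [lsum_succ_self, lsum_self, Fin.sum_snoc]
    omega

theorem chain_succ_eq_sum_box (w : ℕ → ℕ → ℕ → ℂ) (r n : ℕ) :
    chain w (r + 1) n =
      ∑ l ∈ box r n, ∏ s ∈ range (r + 1), w s (lsum n l s) (lsum n l (s + 1)) := by
  induction r generalizing n with
  | zero =>
    rw [chain_one]
    have : box 0 n = {default} := by
      ext l
      simp [mem_box, Subsingleton.elim l default]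
    rw [this]
    simp only [zero_add, range_one, prod_singleton, sum_singleton, lsum_zero]
    rw [show lsum n (default : Fin 0 → ℕ) 1 = n from lsum_succ_self n _]
  | succ r ih =>
    rw [chain]
    simp only [ih, mul_sum]
    rw [sum_sigma']
    refine sum_nbij' (fun s => (Fin.snoc s.2 (s.1 - ∑ i, s.2 i) : Fin (r + 1) → ℕ))
      (fun l => ⟨∑ i, l i, Fin.init l⟩) ?_ ?_ ?_ ?_ ?_
    · rintro ⟨m, l⟩ h
      simp only [mem_sigma, mem_range, mem_box, Fin.sum_snoc] at h ⊢
      omega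
    · intro l h
      simp only [mem_sigma, mem_range, mem_box] at h ⊢
      refine ⟨by omega, ?_⟩
      rw [Fin.sum_univ_castSucc]
      exact Nat.le_add_right _ _
    · rintro ⟨m, l⟩ h
      simp only [mem_sigma, mem_range, mem_box, Fin.sum_snoc, Fin.init_snoc] at h ⊢
      rw [Nat.add_sub_cancel' h.2]
    · intro l h
      have : ∑ i, l i - ∑ i, (Fin.init l : Fin r → ℕ) i = l (Fin.last r) := by
        rw [Fin.sum_univ_castSucc]
        exact Nat.add_sub_cancel_left _ _
      simp only [this, Fin.snoc_init_self]
    · rintro ⟨m, l⟩ h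
      simp only [mem_sigma, mem_range, mem_box] at h
      rw [prod_range_succ _ (r + 1), lsum_succ_self, lsum_snoc n l h.2 le_rfl, lsum_succ_self,
        mul_comm]
      congr 1
      refine prod_congr rfl fun s hs => ?_
      have := mem_range.1 hs
      rw [lsum_snoc n l h.2 (by omega), lsum_snoc n l h.2 (by omega)]

theorem series_eq_sum_box {r n : ℕ} {num den : (Fin r → ℕ) → ℂ}
    (h : ∀ l, n < ∑ i, l i → num l = 0) :
    series num den = ∑ l ∈ box r n, num l / den l := by
  refine tsum_eq_sum fun l hl => ?_
  rw [mem_box, not_le] at hl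
  rw [h l hl, zero_div]

/-! ### The three chain sums for Nørlund's coefficients -/

section weights

variable (X Y : ℕ → ℂ)

/-- `ψ_m` for sequences of parameters. -/
noncomputable def seqPsi (m : ℕ) : ℂ := ∑ j ∈ Icc 1 m, Y j - ∑ j ∈ Icc 1 (m - 1), X j

theorem seqPsi_succ (m : ℕ) : seqPsi X Y (m + 2) = seqPsi X Y (m + 1) + Y (m + 2) - X (m + 1) := by
  simp only [seqPsi, Nat.add_sub_cancel, show m + 2 - 1 = m + 1 by omega]
  rw [sum_Icc_succ_top (by omega : 1 ≤ m + 1 + 1) Y, sum_Icc_succ_top (by omega : 1 ≤ m + 1) X]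
  ring

@[simp] theorem seqPsi_one : seqPsi X Y 1 = Y 1 := by simp [seqPsi]

/-- The weight in Nørlund's recurrence. -/
noncomputable def baseWeight (s m n : ℕ) : ℂ :=
  dpoch (Y (s + 2) - X (s + 1)) (n - m) * poch (seqPsi X Y (s + 1) - X (s + 1) + m) (n - m)

/-- The weight of a step that adds two numerator gamma factors. -/
noncomputable def numWeight (s m n : ℕ) : ℂ :=
  (-1) ^ (n - m) * dpoch (seqPsi X Y (s + 1) - X (s + 1) + m) (n - m) *
    poch (seqPsi X Y (s + 1) - X (s + 2) + m) (n - m)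

/-- The weight of a step that adds two denominator gamma factors. -/
noncomputable def denWeight (s m n : ℕ) : ℂ :=
  dpoch (seqPsi X Y (s + 2) - Y (s + 1) + m) (n - m) *
    poch (seqPsi X Y (s + 2) - Y (s + 2) + m) (n - m)

theorem sum_baseWeight_mul_baseWeight (q : ℕ) {m n : ℕ} (h : m ≤ n) :
    ∑ ij ∈ antidiagonal (n - m),
        baseWeight X Y q m (m + ij.1) * baseWeight X Y (q + 1) (m + ij.1) n =
      ∑ ij ∈ antidiagonal (n - m),
        numWeight X Y q m (m + ij.1) * denWeight X Y (q + 1) (m + ij.1) n := by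
  have h1 := seqPsi_succ X Y q
  have h2 := seqPsi_succ X Y (q + 1)
  -- Here γ - β = y_{q+2} - x_{q+1} and δ - α = y_{q+3} - x_{q+2}, while α and γ, the latter shifted
  -- by the intermediate increment, are the bases of the second factors of the two recurrence
  -- weights.
  have key := sum_dpoch_transform (seqPsi X Y (q + 1) - X (q + 1) + m)
    (seqPsi X Y (q + 1) - X (q + 2) + m) (seqPsi X Y (q + 2) - X (q + 2) + m)
    (seqPsi X Y (q + 3) - Y (q + 2) + m) (n - m)
  have e : ∀ ij ∈ antidiagonal (n - m), n - (m + ij.1) = ij.2 := fun ij hij => by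
    have := HasAntidiagonal.mem_antidiagonal.1 hij
    omega
  refine Eq.trans (sum_congr rfl fun ij hij => ?_) (key.trans (sum_congr rfl fun ij hij => ?_))
  · rw [baseWeight, baseWeight, e ij hij, Nat.add_sub_cancel_left,
      show q + 1 + 2 = q + 3 by omega, show q + 1 + 1 = q + 2 by omega]
    push_cast
    congr 2
    · congr 1
      rw [h1]
      ring
    · congr 1
      rw [show q + 3 = q + 1 + 2 by omega, h2, show q + 1 + 1 = q + 2 by omega, h1]
      ring
    · ring_nf
  · rw [numWeight, denWeight, e ij hij, Nat.add_sub_cancel_left,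
      show q + 1 + 2 = q + 3 by omega, show q + 1 + 1 = q + 2 by omega]
    push_cast
    congr 2
    · ring_nf
    · rw [show q + 3 = q + 1 + 2 by omega, h2, show q + 1 + 1 = q + 2 by omega]
      ring_nf

/-- Alternation of the weights `numWeight` and `denWeight`, beginning with `numWeight` if `e = 0`
and with `denWeight` if `e = 1`. -/
noncomputable def altWeight (e s : ℕ) : ℕ → ℕ → ℂ :=
  if Even (s + e) then numWeight X Y s else denWeight X Y s

theorem altWeight_add_two_mul (e s j : ℕ) :
    altWeight X Y e (e + 2 * j + s) = if Even s then numWeight X Y (e + 2 * j + s)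
      else denWeight X Y (e + 2 * j + s) := by
  have : Even (e + 2 * j + s + e) ↔ Even s := by
    rw [show e + 2 * j + s + e = 2 * (e + j) + s by ring]
    simp [Nat.even_add]
  simp only [altWeight, this]

theorem chain_altWeight_step {q e j : ℕ} (hq : q = e + 2 * j)
    (h : ∀ n, chain (baseWeight X Y) q n = chain (altWeight X Y e) q n) (n : ℕ) :
    chain (baseWeight X Y) (q + 2) n = chain (altWeight X Y e) (q + 2) n := by
  refine chain_add_two_congr (fun m n hmn => ?_) h n
  rw [sum_baseWeight_mul_baseWeight X Y q hmn]
  have h0 := altWeight_add_two_mul X Y e 0 j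
  have h1 := altWeight_add_two_mul X Y e 1 j
  simp only [← hq, add_zero, Even.zero, if_true, Nat.not_even_one, if_false] at h0 h1
  rw [h0, h1]

theorem chain_baseWeight_eq_of_even {q j : ℕ} (hq : q = 2 * j) (n : ℕ) :
    chain (baseWeight X Y) q n = chain (altWeight X Y 0) q n := by
  subst hq
  induction j generalizing n with
  | zero => rfl
  | succ j ih => exact chain_altWeight_step X Y (Nat.zero_add (2 * j)).symm ih n

theorem chain_baseWeight_eq_of_odd {q j : ℕ} (hq : q = 1 + 2 * j) (n : ℕ) :
    chain (baseWeight X Y) q n = chain (altWeight X Y 1) q n := by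
  subst hq
  induction j generalizing n with
  | zero =>
    -- The unpaired first step: ψ_2 - y_1 = y_2 - x_1 and ψ_2 - y_2 = y_1 - x_1, so from L_0 = 0 the
    -- two weights coincide.
    have h1 := seqPsi_succ X Y 0
    simp only [zero_add, seqPsi_one] at h1
    rw [mul_zero, add_zero, chain_one, chain_one, altWeight, if_neg (by simp), baseWeight, denWeight]
    simp only [zero_add, h1, seqPsi_one]
    congr 2 <;> ring
  | succ j ih => exact chain_altWeight_step X Y rfl ih n

/-- Parameters are taken from infinite sequences so that the weights stay the same when the last
components of x and y are dropped in the induction. -/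
theorem coeff_eq_chain {q : ℕ} (x : Fin q → ℂ) (y : Fin (q + 1) → ℂ)
    (hx : ∀ i : Fin q, x i = X (i + 1)) (hy : ∀ i : Fin (q + 1), y i = Y (i + 1)) (n : ℕ) :
    coeff q x y n = chain (baseWeight X Y) q n := by
  induction q generalizing n with
  | zero => rfl
  | succ q ih =>
    rw [coeff, chain]
    refine sum_congr rfl fun m hm => ?_
    have e : excess x (Fin.init y) = seqPsi X Y (q + 1) - X (q + 1) := by
      have sx : ∑ i, x i = ∑ j ∈ Icc 1 (q + 1), X j := by
        rw [← Ico_add_one_right_eq_Icc, sum_Ico_eq_sum_range, Nat.add_sub_cancel,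
          ← Fin.sum_univ_eq_sum_range (fun i => X (1 + i))]
        simp [hx, add_comm 1]
      have sy : ∑ i, (Fin.init y : Fin (q + 1) → ℂ) i = ∑ j ∈ Icc 1 (q + 1), Y j := by
        rw [← Ico_add_one_right_eq_Icc, sum_Ico_eq_sum_range, Nat.add_sub_cancel,
          ← Fin.sum_univ_eq_sum_range (fun i => Y (1 + i))]
        simp [hy, Fin.init, add_comm 1]
      rw [excess, sx, sy, seqPsi, Nat.add_sub_cancel, sum_Icc_succ_top (by omega : 1 ≤ q + 1) X]
      ring
    rw [ih (Fin.init x) (Fin.init y) (fun i => by simp [Fin.init, hx])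
      (fun i => by simp [Fin.init, hy]), e, hx, hy, baseWeight, dpoch]
    rfl

end weights

theorem psi_eq_seqPsi {r : ℕ} (x : Fin (r + 1) → ℂ) (y : Fin (r + 2) → ℂ) (m : ℕ) :
    psi x y m = seqPsi (coord x) (coord y) m := rfl

theorem nu_succ_eq {r : ℕ} (x : Fin (r + 1) → ℂ) (y : Fin (r + 2) → ℂ) (m : ℕ) :
    nu x y (m + 1) = seqPsi (coord x) (coord y) (m + 1) - coord x (m + 1) := by
  rw [nu, seqPsi, sum_sub_distrib, Nat.add_sub_cancel,
    sum_Icc_succ_top (by omega : 1 ≤ m + 1) (coord x)]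
  ring

theorem coeff_eq_chain_coord {r : ℕ} (x : Fin (r + 1) → ℂ) (y : Fin (r + 2) → ℂ) (n : ℕ) :
    coeff (r + 1) x y n = chain (baseWeight (coord x) (coord y)) (r + 1) n :=
  coeff_eq_chain _ _ x y (fun i => (coord_succ x i).symm) (fun i => (coord_succ y i).symm) n

/-! ### The multiple hypergeometric series as chain sums -/

theorem prod_Icc_one {M : Type*} [CommMonoid M] (f : ℕ → M) (r : ℕ) :
    ∏ k ∈ Icc 1 r, f k = ∏ i ∈ range r, f (i + 1) := by
  rw [← Ico_add_one_right_eq_Icc, prod_Ico_eq_prod_range, Nat.add_sub_cancel]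
  simp only [add_comm 1]

theorem prod_range_even {M : Type*} [CommMonoid M] (f : ℕ → M) {N j : ℕ} (h : N = 2 * j) :
    ∏ s ∈ range N, f s = ∏ i ∈ range j, (f (2 * i) * f (2 * i + 1)) := by
  subst h
  induction j with
  | zero => rfl
  | succ j ih =>
    rw [mul_add, mul_one, prod_range_succ, prod_range_succ, prod_range_succ, ih, mul_assoc]

theorem prod_filter_even {M : Type*} [CommMonoid M] (f : ℕ → M) {b j : ℕ} (h : 2 * j ≤ b)
    (h' : b ≤ 2 * j + 1) :
    ∏ m ∈ (Icc 2 b).filter Even, f m = ∏ i ∈ range j, f (2 * i + 2) := by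
  refine (prod_nbij (fun i => 2 * i + 2) (fun i hi => ?_) (fun a _ b _ hab => ?_) (fun m hm => ?_)
    fun _ _ => rfl).symm
  · have := mem_range.1 hi
    rw [mem_filter, mem_Icc]
    exact ⟨by omega, i + 1, by omega⟩
  · simpa using hab
  · rw [mem_coe, mem_filter, mem_Icc] at hm
    obtain ⟨hm, k, rfl⟩ := hm
    exact ⟨k - 1, by simp; omega, by dsimp only; omega⟩

theorem prod_filter_odd {M : Type*} [CommMonoid M] (f : ℕ → M) {b j : ℕ} (h : 2 * j ≤ b + 1)
    (h' : b ≤ 2 * j) :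
    ∏ m ∈ (Icc 1 b).filter Odd, f m = ∏ i ∈ range j, f (2 * i + 1) := by
  refine (prod_nbij (fun i => 2 * i + 1) (fun i hi => ?_) (fun a _ b _ hab => ?_) (fun m hm => ?_)
    fun _ _ => rfl).symm
  · have := mem_range.1 hi
    rw [mem_filter, mem_Icc]
    exact ⟨by omega, i, rfl⟩
  · simpa using hab
  · rw [mem_coe, mem_filter, mem_Icc] at hm
    obtain ⟨hm, k, rfl⟩ := hm
    exact ⟨k, by simp; omega, rfl⟩

theorem lsum_succ_sub {r : ℕ} (n : ℕ) (l : Fin r → ℕ) {s : ℕ} (h : s < r) :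
    lsum n l (s + 1) - lsum n l s = coord l (s + 1) := by
  rw [lsum_succ n l h, Nat.add_sub_cancel_left]

/-- Distributes (-n)_L = (-1)^L n!/(n - L)! over the steps: (n - L)! is the factorial of the last
increment, and the factorials of the other increments cancel against the l_k!. -/
theorem poch_neg_mul_eq {r n : ℕ} {l : Fin r → ℕ} (hl : ∑ i, l i ≤ n) :
    poch (-(n : ℂ)) (lsum n l r) =
      (∏ s ∈ range r, (-1 : ℂ) ^ (lsum n l (s + 1) - lsum n l s)) *
        (∏ s ∈ range (r + 1), (((lsum n l (s + 1) - lsum n l s).factorial : ℂ))⁻¹) *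
        ((∏ k ∈ Icc 1 r, ((coord l k).factorial : ℂ)) * (n.factorial : ℂ)) := by
  have h1 : ∏ s ∈ range r, (-1 : ℂ) ^ (lsum n l (s + 1) - lsum n l s) = (-1) ^ lsum n l r := by
    rw [prod_pow_eq_pow_sum]
    congr 1
    rw [lsum_of_le n l le_rfl, ← Ico_add_one_right_eq_Icc, sum_Ico_eq_sum_range,
      Nat.add_sub_cancel]
    refine sum_congr rfl fun s hs => ?_
    rw [lsum_succ_sub n l (mem_range.1 hs), add_comm 1]
  have h2 : (∏ s ∈ range r, (((lsum n l (s + 1) - lsum n l s).factorial : ℂ))⁻¹) *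
      ∏ k ∈ Icc 1 r, ((coord l k).factorial : ℂ) = 1 := by
    rw [prod_Icc_one, ← prod_mul_distrib]
    refine prod_eq_one fun s hs => ?_
    rw [lsum_succ_sub n l (mem_range.1 hs), inv_mul_cancel₀ (factorial_cast_ne_zero _)]
  rw [h1, prod_range_succ, lsum_succ_self, poch_neg_natCast (lsum_le hl r), div_eq_mul_inv]
  linear_combination -((-1) ^ lsum n l r * ((n - lsum n l r).factorial : ℂ)⁻¹ *
    (n.factorial : ℂ)) * h2

theorem poch_sub_mul_poch (a : ℂ) {n k : ℕ} (h : k ≤ n) :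
    poch a (n - k) * poch (1 - a - n) k = (-1) ^ k * poch a n := by
  have := poch_reflect (a + (n - k : ℕ)) k
  rw [show 1 - (a + (n - k : ℕ)) - (k : ℂ) = 1 - a - n by rw [Nat.cast_sub h]; ring] at this
  rw [this, poch_mul_eq_of_add_eq a (Nat.sub_add_cancel h)]
  ring

section

variable {r : ℕ} (x : Fin (r + 1) → ℂ) (y : Fin (r + 2) → ℂ) (n : ℕ)

theorem firstTerm_eq {l : Fin r → ℕ} (hl : ∑ i, l i ≤ n) (hd : firstDen x y n l ≠ 0) :
    poch (nu x y (r + 1)) n * poch (coord y (r + 2) - coord x (r + 1)) n / (n.factorial : ℂ) *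
        (firstNum x y n l / firstDen x y n l) =
      ∏ s ∈ range (r + 1), baseWeight (coord x) (coord y) s (lsum n l s) (lsum n l (s + 1)) := by
  rw [← mul_div_assoc, div_eq_iff hd]
  -- From (ν)_L (ν + L)_{L' - L} = (ν)_{L'} at each step; the shifted product lacks only its s = 0
  -- factor, which is 1 because L_0 = 0.
  have htel : (∏ s ∈ range (r + 1),
        poch (nu x y (s + 1) + lsum n l s) (lsum n l (s + 1) - lsum n l s)) *
        ∏ s ∈ range r, poch (nu x y (s + 2)) (lsum n l (s + 1)) =
      (∏ s ∈ range r, poch (nu x y (s + 1)) (lsum n l (s + 1))) * poch (nu x y (r + 1)) n := by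
    have e1 : ∏ s ∈ range r, poch (nu x y (s + 2)) (lsum n l (s + 1)) =
        ∏ s ∈ range (r + 1), poch (nu x y (s + 1)) (lsum n l s) := by
      rw [prod_range_succ']
      simp
    have e2 : (∏ s ∈ range r, poch (nu x y (s + 1)) (lsum n l (s + 1))) * poch (nu x y (r + 1)) n =
        ∏ s ∈ range (r + 1), poch (nu x y (s + 1)) (lsum n l (s + 1)) := by
      rw [prod_range_succ, lsum_succ_self]
    rw [e1, e2, ← prod_mul_distrib]
    refine prod_congr rfl fun s hs => ?_
    rw [mul_comm, poch_mul_poch_sub _ (lsum_le_succ hl (Nat.lt_succ_iff.1 (mem_range.1 hs)))]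
  have hd : (∏ s ∈ range r, dpoch (coord y (s + 2) - coord x (s + 1))
        (lsum n l (s + 1) - lsum n l s)) * ∏ s ∈ range r, ((coord l (s + 1)).factorial : ℂ) =
      ∏ s ∈ range r, poch (coord y (s + 2) - coord x (s + 1)) (coord l (s + 1)) := by
    rw [← prod_mul_distrib]
    refine prod_congr rfl fun s hs => ?_
    rw [lsum_succ_sub n l (mem_range.1 hs), mul_comm, factorial_mul_dpoch]
  -- The last increment n - L_r is not a component of l; reflection trades its symbol for one of
  -- full length n over one of length L_r, which is the origin of 1 - y_p + x_{p-1} - n.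
  have hlast : dpoch (coord y (r + 2) - coord x (r + 1)) (n - lsum n l r) *
        poch (1 - coord y (r + 2) + coord x (r + 1) - n) (lsum n l r) =
      poch (coord y (r + 2) - coord x (r + 1)) n / (n.factorial : ℂ) *
        poch (-(n : ℂ)) (lsum n l r) := by
    have := poch_sub_mul_poch (coord y (r + 2) - coord x (r + 1)) (lsum_le hl r)
    rw [← sub_add] at this
    rw [dpoch, poch_neg_natCast (lsum_le hl r), div_mul_eq_mul_div, this]
    have h1 := factorial_cast_ne_zero n
    have h2 := factorial_cast_ne_zero (n - lsum n l r)
    field_simp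
  simp only [baseWeight, ← nu_succ_eq]
  rw [firstNum, firstDen, prod_Icc_one, prod_Icc_one, prod_mul_distrib, prod_mul_distrib,
    prod_mul_distrib, prod_range_succ (fun s => dpoch (coord y (s + 2) - coord x (s + 1)) _),
    lsum_succ_self, ← hd]
  set A := ∏ s ∈ range (r + 1),
        poch (nu x y (s + 1) + lsum n l s) (lsum n l (s + 1) - lsum n l s)
  set B := ∏ s ∈ range r, dpoch (coord y (s + 2) - coord x (s + 1))
        (lsum n l (s + 1) - lsum n l s)
  set C := ∏ s ∈ range r, ((coord l (s + 1)).factorial : ℂ)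
  have htel' : A * ∏ s ∈ range r, poch (nu x y (s + 1 + 1)) (lsum n l (s + 1)) =
    (∏ s ∈ range r, poch (nu x y (s + 1)) (lsum n l (s + 1))) * poch (nu x y (r + 1)) n := htel
  linear_combination (-(B * C) * (∏ s ∈ range r, poch (nu x y (s + 1)) (lsum n l (s + 1))) *
    poch (nu x y (r + 1)) n) * hlast - (B * C *
      dpoch (coord y (r + 2) - coord x (r + 1)) (n - lsum n l r) *
        poch (1 - coord y (r + 2) + coord x (r + 1) - n) (lsum n l r)) * htel'

theorem firstSeries_eq (h : WellDefined n (firstDen x y n)) :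
    firstSeries x y n = coeff (r + 1) x y n := by
  rw [firstSeries, series_eq_sum_box (n := n), coeff_eq_chain_coord, chain_succ_eq_sum_box, mul_sum]
  · exact sum_congr rfl fun l hl => firstTerm_eq x y n (mem_box.1 hl) (h l (mem_box.1 hl))
  · intro l hl
    rw [firstNum, lsum_self, poch_neg_natCast_of_lt hl, zero_mul]

end

/-! ### The second series for odd and even `p` -/

theorem numWeight_mul (X Y : ℕ → ℂ) (s : ℕ) {m n : ℕ} (h : m ≤ n) :
    numWeight X Y s m n *
        (poch (seqPsi X Y (s + 1) - X (s + 1)) m * poch (seqPsi X Y (s + 1) - X (s + 2)) m) =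
      (-1) ^ (n - m) * ((n - m).factorial : ℂ)⁻¹ *
        (poch (seqPsi X Y (s + 1) - X (s + 1)) n * poch (seqPsi X Y (s + 1) - X (s + 2)) n) := by
  rw [numWeight, dpoch, ← poch_mul_poch_sub (seqPsi X Y (s + 1) - X (s + 1)) h,
    ← poch_mul_poch_sub (seqPsi X Y (s + 1) - X (s + 2)) h]
  ring

theorem denWeight_mul (X Y : ℕ → ℂ) (s : ℕ) {m n : ℕ} (h : m ≤ n) :
    denWeight X Y s m n *
        (poch (seqPsi X Y (s + 2) - Y (s + 1)) m * poch (seqPsi X Y (s + 2) - Y (s + 2)) m) =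
      ((n - m).factorial : ℂ)⁻¹ *
        (poch (seqPsi X Y (s + 2) - Y (s + 1)) n * poch (seqPsi X Y (s + 2) - Y (s + 2)) n) := by
  rw [denWeight, dpoch, ← poch_mul_poch_sub (seqPsi X Y (s + 2) - Y (s + 1)) h,
    ← poch_mul_poch_sub (seqPsi X Y (s + 2) - Y (s + 2)) h]
  ring

theorem neg_one_pow_mul_self (k : ℕ) : (-1 : ℂ) ^ k * (-1) ^ k = 1 := by
  rw [← mul_pow]
  simp

/-- Multiplies the identities of a numerator step and the following denominator step into one factor
of the product over even m. -/
theorem mul_eq_regroup {R : Type*} [CommRing R] {u v a b c d σ f g a' b' c' d' : R}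
    (h : u * (a * b) = σ * f * (a' * b')) (h' : v * (c * d) = g * (c' * d')) :
    u * v * (a * b * c * d) = σ * (f * g) * (a' * b' * c' * d') := by
  linear_combination (v * (c * d)) * h + (σ * f * (a' * b')) * h'

theorem mul_eq_of_sign_eq {R : Type*} [CommRing R] {σ ε S I F u d v : R} (h : σ * ε = S)
    (h' : u * d = S * I * v) : σ * I * F * ε * v = u * (F * d) := by
  linear_combination (I * F * v) * h - F * h'

theorem mul_eq_of_mul_eq {R : Type*} [CommRing R] {u d S I f k v : R}
    (h : u * d = S * I * v) : u * (f * k) * d = S * (I * f) * (k * v) := by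
  linear_combination (f * k) * h

theorem oddTerm_eq {j : ℕ} (x : Fin (2 * j + 1 + 1) → ℂ) (y : Fin (2 * j + 1 + 2) → ℂ) (n : ℕ)
    {l : Fin (2 * j + 1) → ℕ} (hl : ∑ i, l i ≤ n) (hd : oddDen x y n l ≠ 0) :
    oddNum x y n l / oddDen x y n l =
      ∏ s ∈ range (2 * j + 1 + 1),
        altWeight (coord x) (coord y) 0 s (lsum n l s) (lsum n l (s + 1)) := by
  rw [div_eq_iff hd, oddNum, oddDen, poch_neg_mul_eq hl]
  -- (-n)_L carries a sign for every step but the last; the explicit signs at even k cancel those of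
  -- the denominator steps, leaving exactly the signs in `numWeight`.
  have hs : (∏ s ∈ range (2 * j + 1), (-1 : ℂ) ^ (lsum n l (s + 1) - lsum n l s)) *
        (∏ k ∈ (Icc 2 (2 * j + 1 - 1)).filter Even, (-1 : ℂ) ^ coord l k) =
      ∏ i ∈ range (j + 1), (-1 : ℂ) ^ (lsum n l (2 * i + 1) - lsum n l (2 * i)) := by
    rw [prod_range_succ, prod_range_succ, prod_range_even (j := j) _ rfl,
      prod_filter_even (j := j) _ (by omega) (by omega), mul_right_comm, ← prod_mul_distrib]
    congr 1
    refine prod_congr rfl fun i hi => ?_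
    have := mem_range.1 hi
    rw [lsum_succ_sub n l (show 2 * i + 1 < 2 * j + 1 by omega), mul_assoc,
      neg_one_pow_mul_self, mul_one]
  have hp : (∏ s ∈ range (2 * j + 1 + 1),
        altWeight (coord x) (coord y) 0 s (lsum n l s) (lsum n l (s + 1))) *
      (∏ m ∈ (Icc 2 (2 * j + 1 + 1)).filter Even,
        poch (psi x y (m - 1) - coord x (m - 1)) (lsum n l (m - 2))
          * poch (psi x y (m - 1) - coord x m) (lsum n l (m - 2))
          * poch (psi x y (m + 1) - coord y m) (lsum n l (m - 1))
          * poch (psi x y (m + 1) - coord y (m + 1)) (lsum n l (m - 1))) =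
      (∏ i ∈ range (j + 1), (-1 : ℂ) ^ (lsum n l (2 * i + 1) - lsum n l (2 * i))) *
        (∏ s ∈ range (2 * j + 1 + 1), (((lsum n l (s + 1) - lsum n l s).factorial : ℂ))⁻¹) *
      (∏ m ∈ (Icc 2 (2 * j + 1 + 1)).filter Even,
        poch (psi x y (m - 1) - coord x (m - 1)) (lsum n l (m - 1))
          * poch (psi x y (m - 1) - coord x m) (lsum n l (m - 1))
          * poch (psi x y (m + 1) - coord y m) (lsum n l m)
          * poch (psi x y (m + 1) - coord y (m + 1)) (lsum n l m)) := by
    rw [prod_filter_even (j := j + 1) _ (by omega) (by omega),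
      prod_filter_even (j := j + 1) _ (by omega) (by omega),
      prod_range_even (N := 2 * j + 1 + 1) (j := j + 1) _ (by ring),
      prod_range_even (N := 2 * j + 1 + 1) (j := j + 1) _ (by ring),
      ← prod_mul_distrib, ← prod_mul_distrib, ← prod_mul_distrib]
    refine prod_congr rfl fun i hi => ?_
    have := mem_range.1 hi
    have h1 := numWeight_mul (coord x) (coord y) (2 * i)
      (lsum_le_succ hl (show 2 * i ≤ 2 * j + 1 by omega))
    have h2 := denWeight_mul (coord x) (coord y) (2 * i + 1)
      (lsum_le_succ hl (show 2 * i + 1 ≤ 2 * j + 1 by omega))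
    have a1 : altWeight (coord x) (coord y) 0 (2 * i) = numWeight (coord x) (coord y) (2 * i) :=
      if_pos ⟨i, by omega⟩
    have a2 : altWeight (coord x) (coord y) 0 (2 * i + 1) =
        denWeight (coord x) (coord y) (2 * i + 1) :=
      if_neg (by simp)
    simp only [a1, a2, psi_eq_seqPsi, show 2 * i + 2 - 1 = 2 * i + 1 by omega,
      show 2 * i + 2 - 2 = 2 * i by omega]
    exact mul_eq_regroup h1 h2
  exact mul_eq_of_sign_eq hs hp

theorem evenTerm_eq {j : ℕ} (hj : 1 ≤ j) (x : Fin (2 * j + 1) → ℂ) (y : Fin (2 * j + 2) → ℂ)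
    (n : ℕ) {l : Fin (2 * j) → ℕ} (hl : ∑ i, l i ≤ n) (hd : evenDen x y n l ≠ 0) :
    evenNum x y n l / evenDen x y n l =
      ∏ s ∈ range (2 * j + 1),
        altWeight (coord x) (coord y) 1 s (lsum n l s) (lsum n l (s + 1)) := by
  rw [div_eq_iff hd, evenNum, evenDen, poch_neg_mul_eq hl]
  have hs : (∏ s ∈ range (2 * j), (-1 : ℂ) ^ (lsum n l (s + 1) - lsum n l s)) *
        (∏ k ∈ (Icc 1 (2 * j - 1)).filter Odd, (-1 : ℂ) ^ coord l k) =
      ∏ i ∈ range j, (-1 : ℂ) ^ (lsum n l (2 * i + 1 + 1) - lsum n l (2 * i + 1)) := by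
    rw [prod_range_even (j := j) _ rfl, prod_filter_odd (j := j) _ (by omega) (by omega),
      ← prod_mul_distrib]
    refine prod_congr rfl fun i hi => ?_
    have := mem_range.1 hi
    rw [lsum_succ_sub n l (show 2 * i < 2 * j by omega), mul_right_comm,
      neg_one_pow_mul_self, one_mul]
  -- The unpaired first step has no denominator symbols since L_0 = 0. Here `1 ≤ j` is needed: for
  -- `j = 0` the convention would make L_1 equal to n instead of l_1.
  have h0 : altWeight (coord x) (coord y) 1 0 (lsum n l 0) (lsum n l (0 + 1)) =
      ((lsum n l (0 + 1) - lsum n l 0).factorial : ℂ)⁻¹ *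
        (poch (psi x y 2 - coord y 2) (coord l 1) * poch (psi x y 2 - coord y 1) (coord l 1)) := by
    have e : lsum n l 1 = coord l 1 := by
      rw [lsum_of_le n l (by omega), Icc_self, sum_singleton]
    rw [altWeight, if_neg (by simp), denWeight, dpoch]
    simp only [zero_add, lsum_zero, Nat.sub_zero, e, psi_eq_seqPsi, Nat.cast_zero, add_zero]
    ring
  have hp : (∏ s ∈ range (2 * j + 1),
        altWeight (coord x) (coord y) 1 s (lsum n l s) (lsum n l (s + 1))) *
      (∏ m ∈ (Icc 2 (2 * j)).filter Even,
        poch (psi x y m - coord x m) (lsum n l (m - 1))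
          * poch (psi x y m - coord x (m + 1)) (lsum n l (m - 1))
          * poch (psi x y (m + 2) - coord y (m + 1)) (lsum n l m)
          * poch (psi x y (m + 2) - coord y (m + 2)) (lsum n l m)) =
      (∏ i ∈ range j, (-1 : ℂ) ^ (lsum n l (2 * i + 1 + 1) - lsum n l (2 * i + 1))) *
        (∏ s ∈ range (2 * j + 1), (((lsum n l (s + 1) - lsum n l s).factorial : ℂ))⁻¹) *
      (poch (psi x y 2 - coord y 2) (coord l 1) * poch (psi x y 2 - coord y 1) (coord l 1) *
      ∏ m ∈ (Icc 2 (2 * j)).filter Even,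
        poch (psi x y m - coord x m) (lsum n l m)
          * poch (psi x y m - coord x (m + 1)) (lsum n l m)
          * poch (psi x y (m + 2) - coord y (m + 1)) (lsum n l (m + 1))
          * poch (psi x y (m + 2) - coord y (m + 2)) (lsum n l (m + 1))) := by
    rw [prod_range_succ', prod_range_succ', h0]
    refine mul_eq_of_mul_eq ?_
    rw [prod_filter_even (j := j) _ (by omega) (by omega),
      prod_filter_even (j := j) _ (by omega) (by omega),
      prod_range_even (j := j) _ rfl, prod_range_even (j := j) _ rfl,
      ← prod_mul_distrib, ← prod_mul_distrib, ← prod_mul_distrib]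
    refine prod_congr rfl fun i hi => ?_
    have := mem_range.1 hi
    have h1 := numWeight_mul (coord x) (coord y) (2 * i + 1)
      (lsum_le_succ hl (show 2 * i + 1 ≤ 2 * j by omega))
    have h2 := denWeight_mul (coord x) (coord y) (2 * i + 2)
      (lsum_le_succ hl (show 2 * i + 2 ≤ 2 * j by omega))
    have a1 : altWeight (coord x) (coord y) 1 (2 * i + 1) =
        numWeight (coord x) (coord y) (2 * i + 1) :=
      if_pos ⟨i + 1, by omega⟩
    have a2 : altWeight (coord x) (coord y) 1 (2 * i + 1 + 1) =
        denWeight (coord x) (coord y) (2 * i + 2) :=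
      if_neg (by rw [Nat.not_even_iff_odd]; exact ⟨i + 1, by omega⟩)
    simp only [a1, a2, psi_eq_seqPsi, show 2 * i + 2 - 1 = 2 * i + 1 by omega]
    exact mul_eq_regroup h1 h2
  rw [mul_assoc _ _ (poch (psi x y 2 - coord y 1) (coord l 1)), mul_assoc]
  exact mul_eq_of_sign_eq hs hp

theorem oddSeries_eq {r : ℕ} (x : Fin (r + 1) → ℂ) (y : Fin (r + 2) → ℂ) (n : ℕ)
    (hr : Odd (r + 2)) (h : WellDefined n (oddDen x y n)) :
    oddSeries x y n = coeff (r + 1) x y n := by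
  obtain ⟨j, rfl⟩ : ∃ j, r = 2 * j + 1 := by
    obtain ⟨j, hj⟩ := hr
    exact ⟨j - 1, by omega⟩
  rw [oddSeries, series_eq_sum_box (n := n), coeff_eq_chain_coord,
    chain_baseWeight_eq_of_even _ _ (j := j + 1) (by ring)]
  · exact (sum_congr rfl fun l hl => oddTerm_eq x y n (mem_box.1 hl) (h l (mem_box.1 hl))).trans
      (chain_succ_eq_sum_box _ _ _).symm
  · intro l hl
    rw [oddNum, lsum_self, poch_neg_natCast_of_lt hl, zero_mul, zero_mul]

theorem evenSeries_eq {r : ℕ} (hr1 : 1 ≤ r) (x : Fin (r + 1) → ℂ) (y : Fin (r + 2) → ℂ) (n : ℕ)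
    (hr : Even (r + 2)) (h : WellDefined n (evenDen x y n)) :
    evenSeries x y n = coeff (r + 1) x y n := by
  obtain ⟨j, rfl⟩ : ∃ j, r = 2 * j := by
    obtain ⟨j, hj⟩ := hr
    exact ⟨j - 1, by omega⟩
  rw [evenSeries, series_eq_sum_box (n := n), coeff_eq_chain_coord,
    chain_baseWeight_eq_of_odd _ _ (j := j) (by ring)]
  · exact (sum_congr rfl fun l hl =>
      evenTerm_eq (by omega) x y n (mem_box.1 hl) (h l (mem_box.1 hl))).trans
      (chain_succ_eq_sum_box _ _ _).symm
  · intro l hl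
    rw [evenNum, lsum_self, poch_neg_natCast_of_lt hl]
    simp only [zero_mul]

/-! ### Gauss's summation theorem -/

theorem norm_poch_le {a : ℂ} {α : ℝ} (h : ‖a‖ ≤ α) (k : ℕ) : ‖poch a k‖ ≤ ‖poch (α : ℂ) k‖ := by
  have hα : 0 ≤ α := (norm_nonneg a).trans h
  simp only [poch_eq_prod, norm_prod]
  refine prod_le_prod (fun _ _ => norm_nonneg _) fun i _ => ?_
  have : ((α : ℂ) + i) = ((α + i : ℝ) : ℂ) := by push_cast; rfl
  rw [this, Complex.norm_real, Real.norm_of_nonneg (by positivity)]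
  exact (norm_add_le _ _).trans (by simpa using h)

theorem norm_poch_ofReal_le {c : ℂ} {γ : ℝ} (h0 : 0 ≤ γ) (h : γ ≤ c.re) (k : ℕ) :
    ‖poch (γ : ℂ) k‖ ≤ ‖poch c k‖ := by
  simp only [poch_eq_prod, norm_prod]
  refine prod_le_prod (fun _ _ => norm_nonneg _) fun i _ => ?_
  have : ((γ : ℂ) + i) = ((γ + i : ℝ) : ℂ) := by push_cast; rfl
  rw [this, Complex.norm_real, Real.norm_of_nonneg (by positivity)]
  refine le_trans ?_ (Complex.re_le_norm _)
  simpa using h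

theorem poch_ne_zero {c : ℂ} (h : 0 < c.re) (k : ℕ) : poch c k ≠ 0 := by
  rw [poch_eq_prod, prod_ne_zero_iff]
  intro i _ h0
  have := congrArg Complex.re h0
  simp only [Complex.add_re, Complex.natCast_re, Complex.zero_re] at this
  have : (0 : ℝ) ≤ i := Nat.cast_nonneg i
  linarith

theorem Gamma_add_natCast {c : ℂ} (h : 0 < c.re) (k : ℕ) :
    Complex.Gamma (c + k) = Complex.Gamma c * poch c k := by
  rw [poch, ← Complex.Gamma_add_nat_div_Gamma_eq, mul_div_cancel₀ _ (Complex.Gamma_ne_zero_of_re_pos h)]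
  rintro m rfl
  have : (0 : ℝ) ≤ m := Nat.cast_nonneg m
  simp only [Complex.neg_re, Complex.natCast_re] at h
  linarith

/-- The general term of the hypergeometric series `₂F₁(a, b; c; 1)`. -/
noncomputable def hyperTerm (a b c : ℂ) (k : ℕ) : ℂ := dpoch a k * poch b k / poch c k

theorem norm_dpoch_le {a : ℂ} {α : ℝ} (h : ‖a‖ ≤ α) (k : ℕ) : ‖dpoch a k‖ ≤ ‖dpoch (α : ℂ) k‖ := by
  rw [dpoch, dpoch, norm_div, norm_div]
  exact div_le_div_of_nonneg_right (norm_poch_le h k) (norm_nonneg _)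

theorem norm_hyperTerm_le {a b c : ℂ} {α β γ : ℝ} (ha : ‖a‖ ≤ α) (hb : ‖b‖ ≤ β) (hγ : 0 < γ)
    (hc : γ ≤ c.re) (k : ℕ) : ‖hyperTerm a b c k‖ ≤ ‖hyperTerm α β γ k‖ := by
  have h0 : 0 < ‖poch (γ : ℂ) k‖ := norm_pos_iff.2 (poch_ne_zero (by simpa using hγ) k)
  rw [hyperTerm, hyperTerm, norm_div, norm_div, norm_mul, norm_mul]
  exact div_le_div₀ (by positivity)
    (mul_le_mul (norm_dpoch_le ha k) (norm_poch_le hb k) (norm_nonneg _) (norm_nonneg _))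
    h0 (norm_poch_ofReal_le hγ.le hc k)

theorem hyperTerm_succ {a b c : ℂ} (h : 0 < c.re) (k : ℕ) :
    ((k : ℂ) + 1) * (c + k) * hyperTerm a b c (k + 1) = (a + k) * (b + k) * hyperTerm a b c k := by
  have h1 := poch_ne_zero h k
  have h2 := poch_ne_zero h (k + 1)
  have h3 := succ_mul_dpoch_succ a k
  rw [poch_succ] at h2
  have h4 := right_ne_zero_of_mul h2
  rw [hyperTerm, hyperTerm, poch_succ, poch_succ]
  field_simp
  linear_combination (poch b k * (b + k)) * h3

/-- The ratio of consecutive terms shows that (k + 1)² times the norm of the k-th term is eventually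
non-increasing. -/
theorem exists_norm_hyperTerm_le {α β γ : ℝ} (hα : 0 ≤ α) (hβ : 0 ≤ β) (hγ : α + β + 2 ≤ γ) :
    ∃ C : ℝ, ∀ᶠ k : ℕ in atTop, ‖hyperTerm α β γ k‖ ≤ C / ((k : ℝ) + 1) ^ 2 := by
  set v : ℕ → ℝ := fun k => ((k : ℝ) + 1) ^ 2 * ‖hyperTerm α β γ k‖ with hv
  -- In `hpoly` the negative lower-order coefficients add up to at most 2(α + β) + 9αβ once each
  -- power of k is raised to k²; the surplus k³ absorbs them, and the 1 ensures k ≥ 1.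
  obtain ⟨K, hK⟩ := exists_nat_ge (2 * (α + β) + 9 * (α * β) + 1)
  have hanti : ∀ k ≥ K, v (k + 1) ≤ v k := by
    intro k hk
    have hk' : 2 * (α + β) + 9 * (α * β) + 1 ≤ (k : ℝ) := hK.trans (by exact_mod_cast hk)
    have hs := congrArg norm (hyperTerm_succ (a := α) (b := β) (c := γ)
      (by simpa using (by positivity : (0 : ℝ) < α + β + 2).trans_le hγ) k)
    have n1 : ‖(k : ℂ) + 1‖ = (k : ℝ) + 1 := by
      exact_mod_cast Complex.norm_natCast (k + 1)
    have n2 : ∀ δ : ℝ, 0 ≤ δ → ‖(δ : ℂ) + k‖ = δ + k := fun δ hδ => by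
      have : ((δ : ℂ) + k) = ((δ + k : ℝ) : ℂ) := by push_cast; rfl
      rw [this, Complex.norm_real, Real.norm_of_nonneg (by positivity)]
    have hγ0 : 0 < γ := by linarith
    rw [norm_mul, norm_mul, norm_mul, norm_mul, n1, n2 _ hα, n2 _ hβ, n2 _ hγ0.le] at hs
    set t := ‖hyperTerm α β γ k‖
    set t' := ‖hyperTerm α β γ (k + 1)‖
    have ht : 0 ≤ t := norm_nonneg _
    have hk0 : (0 : ℝ) ≤ k := Nat.cast_nonneg k
    have hpoly : ((k : ℝ) + 2) ^ 2 * ((α + k) * (β + k)) ≤ ((k : ℝ) + 1) ^ 3 * (γ + k) := by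
      have hp : 0 ≤ α * β := mul_nonneg hα hβ
      have hk1 : (1 : ℝ) ≤ k := by linarith
      have e1 : ((k : ℝ) + 1) ^ 3 * (α + β + 2 + k) ≤ ((k : ℝ) + 1) ^ 3 * (γ + k) := by gcongr
      refine le_trans ?_ e1
      have e2 : 0 ≤ ((k : ℝ) - (2 * (α + β) + 9 * (α * β) + 1)) * k ^ 2 := by
        apply mul_nonneg _ (by positivity); linarith
      have e3 : (α + β) * k ≤ (α + β) * k ^ 2 := by
        apply mul_le_mul_of_nonneg_left _ (by positivity); nlinarith
      have e4 : (α * β) * k ≤ (α * β) * k ^ 2 := by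
        apply mul_le_mul_of_nonneg_left _ (by positivity); nlinarith
      have e5 : α * β ≤ (α * β) * k := by nlinarith
      nlinarith
    have hpos : 0 < ((k : ℝ) + 1) * (γ + k) := by positivity
    have : v (k + 1) * (((k : ℝ) + 1) * (γ + k)) ≤ v k * (((k : ℝ) + 1) * (γ + k)) := by
      simp only [hv]
      push_cast
      calc ((k : ℝ) + 1 + 1) ^ 2 * t' * (((k : ℝ) + 1) * (γ + k))
          = ((k : ℝ) + 2) ^ 2 * ((α + k) * (β + k)) * t := by linear_combination ((k : ℝ) + 2) ^ 2 * hs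
        _ ≤ ((k : ℝ) + 1) ^ 3 * (γ + k) * t := by gcongr
        _ = _ := by ring
    exact le_of_mul_le_mul_right this hpos
  refine ⟨v K, eventually_atTop.2 ⟨K, fun k hk => ?_⟩⟩
  have : v k ≤ v K := Nat.le_induction le_rfl (fun k hk ih => (hanti k hk).trans ih) k hk
  rw [le_div_iff₀ (by positivity), mul_comm]
  exact this

theorem summable_norm_hyperTerm_ofReal {α β γ : ℝ} (hα : 0 ≤ α) (hβ : 0 ≤ β) (hγ : α + β + 2 ≤ γ) :
    Summable fun k => ‖hyperTerm α β γ k‖ := by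
  obtain ⟨C, hC⟩ := exists_norm_hyperTerm_le hα hβ hγ
  have hs : Summable fun k : ℕ => C / ((k : ℝ) + 1) ^ 2 := by
    have := (summable_nat_add_iff 1).2 (Real.summable_one_div_nat_pow.2 (by norm_num : 1 < 2))
    simpa [div_eq_mul_inv] using this.mul_left C
  refine Summable.of_norm_bounded_eventually_nat hs ?_
  simpa using hC

section gauss

variable {a b c : ℂ}

theorem summable_norm_hyperTerm (h : ‖a‖ + ‖b‖ + 2 ≤ c.re) :
    Summable fun k => ‖hyperTerm a b c k‖ :=
  Summable.of_nonneg_of_le (fun _ => norm_nonneg _)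
    (norm_hyperTerm_le le_rfl le_rfl (by positivity) h)
    (summable_norm_hyperTerm_ofReal (norm_nonneg a) (norm_nonneg b) le_rfl)

theorem tendsto_natCast_mul_hyperTerm (h : ‖a‖ + ‖b‖ + 2 ≤ c.re) :
    Tendsto (fun k : ℕ => (k : ℂ) * hyperTerm a b c k) atTop (𝓝 0) := by
  obtain ⟨C, hC⟩ := exists_norm_hyperTerm_le (norm_nonneg a) (norm_nonneg b) le_rfl
  have hC0 : Tendsto (fun k : ℕ => C * (1 / ((k : ℝ) + 1))) atTop (𝓝 0) := by
    simpa using tendsto_one_div_add_atTop_nhds_zero_nat.const_mul C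
  refine squeeze_zero_norm' ?_ hC0
  filter_upwards [hC] with k hk
  have h1 := (norm_hyperTerm_le le_rfl le_rfl (by positivity) h k).trans hk
  rw [norm_mul, Complex.norm_natCast]
  have hk0 : (0 : ℝ) ≤ k := Nat.cast_nonneg k
  calc (k : ℝ) * ‖hyperTerm a b c k‖ ≤ ((k : ℝ) + 1) * (C / ((k : ℝ) + 1) ^ 2) :=
        mul_le_mul (by linarith) h1 (norm_nonneg _) (by positivity)
    _ = C * (1 / ((k : ℝ) + 1)) := by field_simp

theorem re_pos_of_norm_add_le (h : ‖a‖ + ‖b‖ + 2 ≤ c.re) :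
    0 < c.re ∧ 0 < (c - a).re ∧ 0 < (c - b).re ∧ 0 < (c - a - b).re := by
  have h1 := Complex.re_le_norm a
  have h2 := Complex.re_le_norm b
  have h3 := norm_nonneg a
  have h4 := norm_nonneg b
  simp only [Complex.sub_re]
  refine ⟨?_, ?_, ?_, ?_⟩ <;> linarith

/-- The general term of Gauss's series, divided by `Γ(c)`. -/
noncomputable def gaussTerm (a b c : ℂ) (k : ℕ) : ℂ :=
  dpoch a k * poch b k / Complex.Gamma (c + k)

theorem gaussTerm_eq (h : 0 < c.re) (k : ℕ) :
    gaussTerm a b c k = (Complex.Gamma c)⁻¹ * hyperTerm a b c k := by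
  rw [gaussTerm, hyperTerm, Gamma_add_natCast h]
  field_simp

theorem summable_norm_gaussTerm (h : ‖a‖ + ‖b‖ + 2 ≤ c.re) :
    Summable fun k => ‖gaussTerm a b c k‖ := by
  simp only [gaussTerm_eq (re_pos_of_norm_add_le h).1, norm_mul]
  exact (summable_norm_hyperTerm h).mul_left _

theorem gaussTerm_add_one (h : 0 < c.re) (k : ℕ) :
    (c + k) * gaussTerm a b (c + 1) k = gaussTerm a b c k := by
  have h1 : 0 < (c + k).re := by
    simp only [Complex.add_re, Complex.natCast_re]
    positivity
  have h2 : c + k ≠ 0 := fun h0 => by rw [h0] at h1; simp at h1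
  rw [gaussTerm, gaussTerm, show c + 1 + (k : ℂ) = c + k + 1 by ring, Complex.Gamma_add_one _ h2]
  field_simp

/-- The contiguous relation c ↦ c + 1 for Gauss's series, holding termwise up to a difference whose
sum telescopes. -/
theorem gaussTerm_telescope (h : 0 < c.re) (k : ℕ) :
    (c - a - b) * gaussTerm a b c k - (c - a) * (c - b) * gaussTerm a b (c + 1) k =
      (k : ℂ) * gaussTerm a b c k - ((k + 1 : ℕ) : ℂ) * gaussTerm a b c (k + 1) := by
  have h1 : 0 < (c + k).re := by
    simp only [Complex.add_re, Complex.natCast_re]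
    positivity
  have h2 : c + k ≠ 0 := fun h0 => by rw [h0] at h1; simp at h1
  have e1 := gaussTerm_add_one (a := a) (b := b) h k
  have e2 : ((k : ℂ) + 1) * (c + k) * gaussTerm a b c (k + 1) =
      (a + k) * (b + k) * gaussTerm a b c k := by
    rw [gaussTerm_eq h, gaussTerm_eq h]
    linear_combination (Complex.Gamma c)⁻¹ * hyperTerm_succ (a := a) (b := b) h k
  apply mul_left_cancel₀ h2
  push_cast
  linear_combination -((c - a) * (c - b)) * e1 + e2

theorem tsum_gaussTerm_add_one (h : ‖a‖ + ‖b‖ + 2 ≤ c.re) :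
    (c - a - b) * ∑' k, gaussTerm a b c k = (c - a) * (c - b) * ∑' k, gaussTerm a b (c + 1) k := by
  have hc := (re_pos_of_norm_add_le h).1
  have h' : ‖a‖ + ‖b‖ + 2 ≤ (c + 1).re := by
    rw [Complex.add_re, Complex.one_re]
    linarith
  have s1 := (summable_norm_gaussTerm h).of_norm.hasSum.mul_left (c - a - b)
  have s2 := (summable_norm_gaussTerm h').of_norm.hasSum.mul_left ((c - a) * (c - b))
  have s3 := (s1.sub s2).tendsto_sum_nat
  have s4 : Tendsto (fun N : ℕ => (Complex.Gamma c)⁻¹ * ((N : ℂ) * hyperTerm a b c N)) atTop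
      (𝓝 ((Complex.Gamma c)⁻¹ * 0)) := (tendsto_natCast_mul_hyperTerm h).const_mul _
  rw [mul_zero] at s4
  have s5 := s4.neg
  rw [neg_zero] at s5
  refine sub_eq_zero.1 (tendsto_nhds_unique s3 (s5.congr fun N => ?_))
  simp only [gaussTerm_telescope hc]
  rw [sum_range_sub' (fun k : ℕ => (k : ℂ) * gaussTerm a b c k) N, gaussTerm_eq hc N]
  simp
  ring

/-- Euler's limit formula for Γ, rewritten with Γ(s + n + 1) = Γ(s) (s)_{n+1}. -/
theorem tendsto_Gamma_ratio {s : ℂ} (hs : 0 < s.re) :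
    Tendsto (fun n : ℕ => Complex.Gamma (s + (n + 1 : ℕ)) / ((n : ℂ) ^ s * (n.factorial : ℂ)))
      atTop (𝓝 1) := by
  have h0 := Complex.Gamma_ne_zero_of_re_pos hs
  have h := (tendsto_const_nhds (x := Complex.Gamma s)).div (Complex.GammaSeq_tendsto_Gamma s) h0
  rw [div_self h0] at h
  refine h.congr fun n => ?_
  rw [Gamma_add_natCast hs, poch_eq_prod, Pi.div_apply, Complex.GammaSeq, div_div_eq_mul_div]

theorem tendsto_Gamma_mul_Gamma (h : ‖a‖ + ‖b‖ + 2 ≤ c.re) :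
    Tendsto (fun n : ℕ => Complex.Gamma (c - a + (n + 1 : ℕ)) * Complex.Gamma (c - b + (n + 1 : ℕ)) /
      (Complex.Gamma (c - a - b + (n + 1 : ℕ)) * Complex.Gamma (c + (n + 1 : ℕ)))) atTop (𝓝 1) := by
  obtain ⟨h1, h2, h3, h4⟩ := re_pos_of_norm_add_le h
  have := ((tendsto_Gamma_ratio h2).mul (tendsto_Gamma_ratio h3)).div
    ((tendsto_Gamma_ratio h4).mul (tendsto_Gamma_ratio h1)) (by simp)
  simp only [mul_one, div_one] at this
  refine this.congr' ?_
  filter_upwards [eventually_gt_atTop 0] with n hn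
  have hn' : (n : ℂ) ≠ 0 := by exact_mod_cast hn.ne'
  -- The exponents have equal sums, (c - a) + (c - b) = (c - a - b) + c, so all powers of n cancel.
  have e : (n : ℂ) ^ (c - a) * (n : ℂ) ^ (c - b) = (n : ℂ) ^ (c - a - b) * (n : ℂ) ^ c := by
    rw [← Complex.cpow_add _ _ hn', ← Complex.cpow_add _ _ hn']
    ring_nf
  have p1 : ∀ s : ℂ, (n : ℂ) ^ s ≠ 0 := fun s => by simp [Complex.cpow_eq_zero_iff, hn']
  have f := factorial_cast_ne_zero n
  simp only [Pi.div_apply]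
  rw [div_mul_div_comm, div_mul_div_comm, div_div_div_comm]
  have : (n : ℂ) ^ (c - a) * (n.factorial : ℂ) * ((n : ℂ) ^ (c - b) * (n.factorial : ℂ)) =
      (n : ℂ) ^ (c - a - b) * (n.factorial : ℂ) * ((n : ℂ) ^ c * (n.factorial : ℂ)) := by
    linear_combination ((n.factorial : ℂ)) ^ 2 * e
  rw [this, div_self, div_one]
  exact mul_ne_zero (mul_ne_zero (p1 _) f) (mul_ne_zero (p1 _) f)

theorem tendsto_inv_poch_add {k : ℕ} (hk : k ≠ 0) (hc : 0 < c.re) :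
    Tendsto (fun n : ℕ => (poch (c + n) k)⁻¹) atTop (𝓝 0) := by
  refine squeeze_zero_norm' ?_ tendsto_inv_atTop_nhds_zero_nat
  filter_upwards [eventually_gt_atTop 0] with n hn
  have hn1 : (1 : ℝ) ≤ n := by exact_mod_cast hn
  rw [norm_inv]
  refine inv_anti₀ (by positivity) ?_
  obtain ⟨k, rfl⟩ := Nat.exists_eq_succ_of_ne_zero hk
  have hre : ∀ i : ℕ, (n : ℝ) ≤ ‖c + n + i‖ := fun i => by
    refine le_trans ?_ (Complex.re_le_norm _)
    simp only [Complex.add_re, Complex.natCast_re]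
    have : (0 : ℝ) ≤ i := Nat.cast_nonneg i
    linarith
  rw [poch_eq_prod, prod_range_succ, norm_mul, norm_prod]
  have : (1 : ℝ) ≤ ∏ i ∈ range k, ‖c + n + i‖ := by
    refine le_trans (by simp) (prod_le_prod (s := range k) (f := fun _ => (1 : ℝ)) (fun _ _ => by norm_num)
      fun i _ => hn1.trans (hre i))
  nlinarith [hre k]

theorem tendsto_tsum_hyperTerm (h : ‖a‖ + ‖b‖ + 2 ≤ c.re) :
    Tendsto (fun n : ℕ => ∑' k, hyperTerm a b (c + n) k) atTop (𝓝 1) := by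
  have hc := (re_pos_of_norm_add_le h).1
  have key := tendsto_tsum_of_dominated_convergence (𝓕 := atTop)
    (f := fun (n : ℕ) k => hyperTerm a b (c + n) k) (g := fun k => if k = 0 then (1 : ℂ) else 0)
    (bound := fun k => ‖hyperTerm (‖a‖ : ℝ) (‖b‖ : ℝ) ((‖a‖ + ‖b‖ + 2 : ℝ) : ℂ) k‖)
    (summable_norm_hyperTerm_ofReal (norm_nonneg a) (norm_nonneg b) le_rfl) ?_ ?_
  · simpa using key
  · intro k
    by_cases hk : k = 0
    · subst hk
      simp [hyperTerm, dpoch]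
    · simp only [hyperTerm, div_eq_mul_inv, if_neg hk]
      simpa using (tendsto_inv_poch_add hk hc).const_mul (dpoch a k * poch b k)
  · refine Eventually.of_forall fun n k => norm_hyperTerm_le le_rfl le_rfl (by positivity) ?_ k
    rw [Complex.add_re, Complex.natCast_re]
    have : (0 : ℝ) ≤ n := Nat.cast_nonneg n
    linarith

/-- Gauss's summation theorem. -/
theorem hasSum_gaussTerm (h : ‖a‖ + ‖b‖ + 2 ≤ c.re) :
    HasSum (gaussTerm a b c)
      (Complex.Gamma (c - a - b) / (Complex.Gamma (c - a) * Complex.Gamma (c - b))) := by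
  obtain ⟨h1, h2, h3, h4⟩ := re_pos_of_norm_add_le h
  have hn : ∀ n : ℕ, ‖a‖ + ‖b‖ + 2 ≤ (c + n).re := fun n => by
    rw [Complex.add_re, Complex.natCast_re]
    have : (0 : ℝ) ≤ n := Nat.cast_nonneg n
    linarith
  -- G n is the series at c + n divided by its claimed value; it is constant in n by the contiguous
  -- relation and tends to 1.
  set G : ℕ → ℂ := fun n => (∑' k, gaussTerm a b (c + n) k) * (Complex.Gamma (c - a + n) *
    Complex.Gamma (c - b + n) / Complex.Gamma (c - a - b + n)) with hG
  have hper : ∀ n, G n = G 0 := by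
    intro n
    induction n with
    | zero => rfl
    | succ n ih =>
      rw [← ih]
      obtain ⟨k1, k2, k3, k4⟩ := re_pos_of_norm_add_le (hn n)
      have ne : ∀ {w : ℂ}, 0 < w.re → w ≠ 0 := fun hw h0 => by simp [h0] at hw
      have key := tsum_gaussTerm_add_one (hn n)
      have g1 := Complex.Gamma_ne_zero_of_re_pos k4
      have g2 := ne k4
      simp only [hG]
      push_cast
      rw [← add_assoc, ← add_assoc, ← add_assoc, ← add_assoc,
        show c - a + (n : ℂ) = c + n - a by ring, show c - b + (n : ℂ) = c + n - b by ring,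
        show c - a - b + (n : ℂ) = c + n - a - b by ring, Complex.Gamma_add_one _ (ne k2),
        Complex.Gamma_add_one _ (ne k3), Complex.Gamma_add_one _ (ne k4)]
      field_simp
      linear_combination -(Complex.Gamma (c + n - a) * Complex.Gamma (c + n - b)) * key
  have hlim : Tendsto (fun n : ℕ => G (n + 1)) atTop (𝓝 1) := by
    have := ((tendsto_tsum_hyperTerm h).comp (tendsto_add_atTop_nat 1)).mul
      (tendsto_Gamma_mul_Gamma h)
    rw [mul_one] at this
    refine this.congr fun n => ?_
    simp only [Function.comp_apply, hG]
    have : ∑' k, gaussTerm a b (c + (n + 1 : ℕ)) k =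
        (Complex.Gamma (c + (n + 1 : ℕ)))⁻¹ * ∑' k, hyperTerm a b (c + (n + 1 : ℕ)) k := by
      rw [← tsum_mul_left]
      exact tsum_congr fun k => gaussTerm_eq (re_pos_of_norm_add_le (hn (n + 1))).1 k
    rw [this]
    field_simp
  have h0 : G 0 = 1 := by
    refine tendsto_nhds_unique (tendsto_const_nhds.congr fun n => ?_) hlim
    exact (hper (n + 1)).symm
  have hval : ∑' k, gaussTerm a b c k =
      Complex.Gamma (c - a - b) / (Complex.Gamma (c - a) * Complex.Gamma (c - b)) := by
    simp only [hG, Nat.cast_zero, add_zero] at h0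
    have g1 := Complex.Gamma_ne_zero_of_re_pos h2
    have g2 := Complex.Gamma_ne_zero_of_re_pos h3
    have g3 := Complex.Gamma_ne_zero_of_re_pos h4
    field_simp at h0 ⊢
    linear_combination h0
  rw [← hval]
  exact (summable_norm_gaussTerm h).of_norm.hasSum

end gauss

/-! ### The inverse gamma series -/

theorem norm_poch_ofReal_eq {α : ℝ} (hα : 0 ≤ α) (k : ℕ) :
    ((‖poch (α : ℂ) k‖ : ℝ) : ℂ) = poch α k := by
  rw [poch_eq_prod, norm_prod, Complex.ofReal_prod]
  refine prod_congr rfl fun i _ => ?_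
  have : ((α : ℂ) + i) = ((α + i : ℝ) : ℂ) := by push_cast; rfl
  rw [this, Complex.norm_real, Real.norm_of_nonneg (by positivity)]

theorem norm_gaussTerm_ofReal_eq {α β γ : ℝ} (hα : 0 ≤ α) (hβ : 0 ≤ β) (hγ : 0 < γ) (k : ℕ) :
    ((‖gaussTerm α β γ k‖ : ℝ) : ℂ) = gaussTerm α β γ k := by
  have e : Complex.Gamma (γ + k) = ((Real.Gamma (γ + k) : ℝ) : ℂ) := by
    rw [← Complex.Gamma_ofReal]
    push_cast
    rfl
  rw [gaussTerm, dpoch, norm_div, norm_mul, norm_div, Complex.ofReal_div, Complex.ofReal_mul,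
    Complex.ofReal_div, norm_poch_ofReal_eq hα, norm_poch_ofReal_eq hβ, Complex.norm_natCast, e,
    Complex.norm_real, Real.norm_of_nonneg (Real.Gamma_pos_of_pos (by positivity)).le]
  rfl

theorem hasSum_norm_gaussTerm_ofReal {α β γ : ℝ} (hα : 0 ≤ α) (hβ : 0 ≤ β)
    (hγ : α + β + 2 ≤ γ) :
    HasSum (fun k => ‖gaussTerm α β γ k‖) ‖Complex.Gamma (γ - α - β) /
      (Complex.Gamma (γ - α) * Complex.Gamma (γ - β))‖ := by
  have h : ‖(α : ℂ)‖ + ‖(β : ℂ)‖ + 2 ≤ (γ : ℂ).re := by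
    simpa [abs_of_nonneg, hα, hβ] using hγ
  have h1 := (summable_norm_gaussTerm h).hasSum
  have h2 := Complex.hasSum_ofReal.2 h1
  simp only [norm_gaussTerm_ofReal_eq hα hβ (by linarith : 0 < γ)] at h2
  rw [← h2.unique (hasSum_gaussTerm h), Complex.norm_real,
    Real.norm_of_nonneg (tsum_nonneg fun _ => norm_nonneg _)]
  exact h1

/-- Γ(w + n) = Γ(w) (w)_n and |(w)_n| ≥ (Re w)_n. The constant is independent of n, which the
majorant of the double series requires. -/
theorem norm_inv_Gamma_add_le {w : ℂ} (hw : 0 < w.re) (n : ℕ) :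
    ‖(Complex.Gamma (w + n))⁻¹‖ ≤
      ‖Complex.Gamma w.re‖ / ‖Complex.Gamma w‖ * ‖(Complex.Gamma (w.re + n))⁻¹‖ := by
  have hw' : 0 < ((w.re : ℝ) : ℂ).re := by simpa using hw
  have g1 := norm_pos_iff.2 (Complex.Gamma_ne_zero_of_re_pos hw)
  have g2 := norm_pos_iff.2 (Complex.Gamma_ne_zero_of_re_pos hw')
  have p1 := norm_pos_iff.2 (poch_ne_zero hw n)
  have p2 := norm_pos_iff.2 (poch_ne_zero hw' n)
  have p3 := norm_poch_ofReal_le hw.le le_rfl n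
  rw [Gamma_add_natCast hw, Gamma_add_natCast hw', norm_inv, norm_inv, norm_mul, norm_mul]
  calc (‖Complex.Gamma w‖ * ‖poch w n‖)⁻¹
      ≤ (‖Complex.Gamma w‖ * ‖poch (w.re : ℂ) n‖)⁻¹ := by gcongr
    _ = _ := by field_simp

theorem norm_gaussTerm_add_le {a b w : ℂ} (hw : 0 < w.re) (m k : ℕ) :
    ‖gaussTerm a (b + m) (w + m) k‖ ≤ ‖Complex.Gamma w.re‖ / ‖Complex.Gamma w‖ *
      ‖gaussTerm (‖a‖ : ℝ) ((‖b‖ + m : ℝ) : ℂ) ((w.re + m : ℝ) : ℂ) k‖ := by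
  have hb : ‖b + m‖ ≤ ‖b‖ + m := (norm_add_le _ _).trans (by simp)
  have h1 := norm_inv_Gamma_add_le hw (m + k)
  push_cast at h1
  rw [← add_assoc, ← add_assoc] at h1
  rw [gaussTerm, gaussTerm, div_eq_mul_inv, div_eq_mul_inv _ (Complex.Gamma _), norm_mul, norm_mul,
    norm_mul, norm_mul]
  calc _ ≤ ‖dpoch (‖a‖ : ℝ) k‖ * ‖poch ((‖b‖ + m : ℝ) : ℂ) k‖ *
      (‖Complex.Gamma w.re‖ / ‖Complex.Gamma w‖ * ‖(Complex.Gamma (w.re + m + k))⁻¹‖) :=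
        mul_le_mul (mul_le_mul (norm_dpoch_le le_rfl k) (norm_poch_le hb k) (norm_nonneg _)
          (norm_nonneg _)) h1 (norm_nonneg _) (by positivity)
    _ = _ := by
      push_cast
      ring

/-- The terms are majorised by Gauss terms with real parameters, whose inner sums are known in
closed form: a constant times |g_m / Γ(Re w - ‖a‖ + m)|. Thus convergence of the previous inverse
gamma series suffices. -/
theorem summable_mul_gaussTerm {g : ℕ → ℂ} {a b w : ℂ} (hw : ‖a‖ + ‖b‖ + 2 ≤ w.re)
    (hg : Summable fun m : ℕ => g m / Complex.Gamma (w.re - ‖a‖ + m)) :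
    Summable fun p : ℕ × ℕ => g p.1 * gaussTerm a (b + p.1) (w + p.1) p.2 := by
  have hw0 : 0 < w.re := by
    have := norm_nonneg a
    have := norm_nonneg b
    linarith
  set C := ‖Complex.Gamma w.re‖ / ‖Complex.Gamma w‖
  have hs : ∀ m : ℕ, HasSum
      (fun k => ‖gaussTerm (‖a‖ : ℝ) ((‖b‖ + m : ℝ) : ℂ) ((w.re + m : ℝ) : ℂ) k‖)
      ‖Complex.Gamma (w.re - ‖a‖ - ‖b‖) /
        (Complex.Gamma (w.re - ‖a‖ + m) * Complex.Gamma (w.re - ‖b‖))‖ := fun m => by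
    have := hasSum_norm_gaussTerm_ofReal (α := ‖a‖) (β := ‖b‖ + m) (γ := w.re + m) (by positivity)
      (by positivity) (by linarith)
    convert! this using 3
    · push_cast
      ring_nf
    · push_cast
      ring_nf
  have hmaj : Summable fun p : ℕ × ℕ => ‖g p.1‖ * (C *
      ‖gaussTerm (‖a‖ : ℝ) ((‖b‖ + p.1 : ℝ) : ℂ) ((w.re + p.1 : ℝ) : ℂ) p.2‖) := by
    rw [summable_prod_of_nonneg (fun p => by positivity)]
    refine ⟨fun m => ((hs m).summable.mul_left C).mul_left ‖g m‖, ?_⟩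
    have e : ∀ m : ℕ, ∑' k, ‖g m‖ * (C *
        ‖gaussTerm (‖a‖ : ℝ) ((‖b‖ + m : ℝ) : ℂ) ((w.re + m : ℝ) : ℂ) k‖) =
        (C * ‖Complex.Gamma (w.re - ‖a‖ - ‖b‖) / Complex.Gamma (w.re - ‖b‖)‖) *
          ‖g m / Complex.Gamma (w.re - ‖a‖ + m)‖ := fun m => by
      rw [(((hs m).mul_left C).mul_left ‖g m‖).tsum_eq]
      simp only [norm_div, norm_mul]
      ring
    simp only [e]
    exact hg.norm.mul_left _
  refine Summable.of_norm (hmaj.of_nonneg_of_le (fun _ => norm_nonneg _) fun p => ?_)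
  rw [norm_mul]
  exact mul_le_mul_of_nonneg_left (norm_gaussTerm_add_le hw0 p.1 p.2) (norm_nonneg _)

theorem isInverseGammaSeries_coeff {q : ℕ} (x : Fin q → ℂ) (y : Fin (q + 1) → ℂ) :
    IsInverseGammaSeries x y (coeff q x y) := by
  induction q with
  | zero =>
    refine ⟨0, fun z _ => ?_⟩
    have := hasSum_ite_eq (0 : ℕ) (1 / Complex.Gamma (z + y 0))
    convert! this using 1
    · ext n
      by_cases hn : n = 0
      · subst hn
        simp [coeff, excess]
      · simp [coeff, hn]
    · simp
  | succ q ih =>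
    obtain ⟨R, hR⟩ := ih (Fin.init x) (Fin.init y)
    set xl := x (Fin.last q) with hxl
    set yl := y (Fin.last (q + 1)) with hyl
    set a := yl - xl with ha
    set b := excess x (Fin.init y) with hb
    set d := excess (Fin.init x : Fin q → ℂ) (Fin.init y : Fin (q + 1) → ℂ) with hd
    have hbd : b = d - xl := by
      rw [hb, hd, excess, excess, Fin.sum_univ_castSucc (f := x)]
      simp only [Fin.init, hxl]
      ring
    have hxy : excess x y = d + a := by
      rw [hd, ha, excess, excess, Fin.sum_univ_castSucc (f := x), Fin.sum_univ_castSucc (f := y)]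
      simp only [Fin.init, hxl, hyl]
      ring
    -- The second bound gives both Re w ≥ ‖a‖ + ‖b‖ + 2, needed for Gauss's theorem, and Re(Re w -
    -- ‖a‖ - d) > R, so that the previous series converges at that point.
    refine ⟨max R (R + ‖a‖ + ‖b‖ + 2 + |R| - (d + a).re + |d.re|), fun z hz => ?_⟩
    have hz1 : R < z.re := (le_max_left _ _).trans_lt hz
    have hz2 := (le_max_right _ _).trans_lt hz
    rw [hxy]
    set w := z + (d + a) with hw
    have hwre : w.re = z.re + (d + a).re := by rw [hw, Complex.add_re]
    have hR1 := neg_abs_le R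
    have hR2 := le_abs_self d.re
    have hR3 := abs_nonneg d.re
    have hn1 := norm_nonneg a
    have hn2 := norm_nonneg b
    have hw1 : ‖a‖ + ‖b‖ + 2 ≤ w.re := by linarith
    have hg : Summable fun m : ℕ => coeff q (Fin.init x) (Fin.init y) m /
        Complex.Gamma (w.re - ‖a‖ + m) := by
      have := (hR (w.re - ‖a‖ - d) (by simp; linarith [abs_nonneg R])).summable
      simpa only [← hd, sub_add_cancel] using this
    have hsum := summable_mul_gaussTerm hw1 hg
    have hgauss : ∀ m : ℕ, HasSum (fun k => coeff q (Fin.init x) (Fin.init y) m *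
        gaussTerm a (b + m) (w + m) k)
        (coeff q (Fin.init x) (Fin.init y) m / Complex.Gamma (z + d + m) *
          (Complex.Gamma (z + xl) / Complex.Gamma (z + yl))) := fun m => by
      have h1 : ‖b + m‖ ≤ ‖b‖ + m := (norm_add_le _ _).trans (by simp)
      have := (hasSum_gaussTerm (a := a) (b := b + m) (c := w + m)
        (by rw [Complex.add_re, Complex.natCast_re]; linarith)).mul_left
        (coeff q (Fin.init x) (Fin.init y) m)
      rw [show w + m - a - (b + m) = z + xl by rw [hw, hbd]; ring,
        show w + m - a = z + d + m by rw [hw]; ring,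
        show w + m - (b + m) = z + yl by rw [hw, hbd, ha]; ring] at this
      convert! this using 1
      rw [div_mul_div_comm, mul_div]
    -- Rows of the double series are Gauss sums and give the gamma quotient; its antidiagonals m + k
    -- = n give the recurrence for the coefficients.
    have hval := (hsum.hasSum.prod_fiberwise hgauss).unique
      ((hR z hz1).mul_right (Complex.Gamma (z + xl) / Complex.Gamma (z + yl)))
    have htot := hsum.hasSum
    rw [hval, ← HasAntidiagonal.sigmaAntidiagonalEquivProd.hasSum_iff] at htot
    have hanti := htot.sigma fun n => hasSum_fintype _
    convert! hanti using 1
    · ext n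
      refine Eq.trans ?_ (sum_coe_sort (antidiagonal n) (fun p : ℕ × ℕ =>
        coeff q (Fin.init x) (Fin.init y) p.1 * gaussTerm a (b + p.1) (w + p.1) p.2)).symm
      rw [Nat.sum_antidiagonal_eq_sum_range_succ_mk, coeff, sum_div]
      refine sum_congr rfl fun m hm => ?_
      have hmn : m ≤ n := Nat.lt_succ_iff.1 (mem_range.1 hm)
      rw [gaussTerm, dpoch, show w + m + ((n - m : ℕ) : ℂ) = w + n by rw [Nat.cast_sub hmn]; ring]
      ring
    · rw [Fin.prod_univ_castSucc, Fin.prod_univ_castSucc (n := q + 1), div_mul_div_comm]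
      rfl

/-! ### Uniqueness of inverse gamma series, symmetries and positivity -/

/-- After multiplication by Γ(w + j) the n-th term is d_n / (w + j)_n; as j → ∞ only n = 0 survives,
with the terms at j = 0 as a summable bound. -/
theorem eq_zero_of_hasSum_inverseGamma {d : ℕ → ℂ} {c : ℂ} {R : ℝ}
    (h : ∀ z : ℂ, R < z.re → HasSum (fun n : ℕ => d n / Complex.Gamma (z + c + n)) 0) :
    d 0 = 0 := by
  set z₀ : ℂ := ((|R| + |c.re| + 1 : ℝ) : ℂ) with hz₀
  set w : ℂ := z₀ + c with hw
  have hz : R < z₀.re := by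
    rw [hz₀, Complex.ofReal_re]
    linarith [le_abs_self R, abs_nonneg c.re]
  have hwre : 0 < w.re := by
    rw [hw, Complex.add_re, hz₀, Complex.ofReal_re]
    linarith [neg_abs_le c.re, abs_nonneg R]
  have hj : ∀ j : ℕ, 0 < (w + j).re := fun j => by
    rw [Complex.add_re, Complex.natCast_re]
    positivity
  have hsum : ∀ j : ℕ, HasSum (fun n => d n * (poch (w + j) n)⁻¹) 0 := fun j => by
    have := (h (z₀ + j) (by
      rw [Complex.add_re, Complex.natCast_re]
      linarith [(Nat.cast_nonneg j : (0 : ℝ) ≤ j)])).mul_left (Complex.Gamma (w + j))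
    rw [mul_zero] at this
    refine this.congr_fun fun n => ?_
    have g := Complex.Gamma_ne_zero_of_re_pos (hj j)
    rw [show z₀ + j + c + (n : ℂ) = w + j + n by rw [hw]; ring, Gamma_add_natCast (hj j)]
    field_simp
  have key := tendsto_tsum_of_dominated_convergence (𝓕 := atTop)
    (f := fun (j : ℕ) n => d n * (poch (w + j) n)⁻¹) (g := fun n => if n = 0 then d 0 else 0)
    (bound := fun n => ‖d n * (poch w n)⁻¹‖) ?_ ?_ ?_
  · simp only [(hsum _).tsum_eq, tsum_ite_eq] at key
    exact (tendsto_nhds_unique key tendsto_const_nhds)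
  · simpa using (hsum 0).summable.norm
  · intro n
    by_cases hn : n = 0
    · subst hn
      simp
    · simpa [hn] using (tendsto_inv_poch_add hn hwre).const_mul (d n)
  · refine Eventually.of_forall fun j n => ?_
    rw [norm_mul, norm_mul, norm_inv, norm_inv]
    refine mul_le_mul_of_nonneg_left (inv_anti₀ (norm_pos_iff.2 (poch_ne_zero hwre n)) ?_)
      (norm_nonneg _)
    simp only [poch_eq_prod, norm_prod]
    refine prod_le_prod (fun _ _ => norm_nonneg _) fun i _ => ?_
    rw [add_right_comm w (j : ℂ)]
    have hre : 0 ≤ (w + i).re := (hj i).le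
    rw [Complex.norm_def, Complex.norm_def]
    refine Real.sqrt_le_sqrt ?_
    rw [Complex.normSq_apply, Complex.normSq_apply, Complex.add_re (w + i), Complex.add_im (w + i),
      Complex.natCast_re, Complex.natCast_im, add_zero]
    have : (0 : ℝ) ≤ j := Nat.cast_nonneg j
    nlinarith [mul_nonneg hre this]

theorem IsInverseGammaSeries.unique {k m : ℕ} {x : Fin k → ℂ} {y : Fin m → ℂ} {g h : ℕ → ℂ}
    (hg : IsInverseGammaSeries x y g) (hh : IsInverseGammaSeries x y h) : g = h := by
  obtain ⟨R, hR⟩ := hg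
  obtain ⟨S, hS⟩ := hh
  have hd : ∀ z : ℂ, max R S < z.re →
      HasSum (fun n : ℕ => (g n - h n) / Complex.Gamma (z + excess x y + n)) 0 := fun z hz => by
    have := (hR z ((le_max_left _ _).trans_lt hz)).sub (hS z ((le_max_right _ _).trans_lt hz))
    simpa only [sub_self, ← sub_div] using this
  funext N
  induction N using Nat.strong_induction_on with
  | _ N ih =>
    refine sub_eq_zero.1 ?_
    -- The first N differences vanish by induction, so the remainder is again an inverse gamma
    -- series, with N added to the argument.
    have := eq_zero_of_hasSum_inverseGamma (d := fun n => g (n + N) - h (n + N))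
      (c := excess x y + N) (R := max R S) fun z hz => ?_
    · simpa using this
    · have h1 := (hasSum_nat_add_iff' N).2 (hd z hz)
      rw [sum_eq_zero fun i hi => by rw [ih i (mem_range.1 hi), sub_self, zero_div], sub_zero] at h1
      refine h1.congr_fun fun n => ?_
      push_cast
      ring_nf

/-- By uniqueness the coefficients depend only on the gamma quotient and the excess, hence only on
the multisets of parameters. -/
theorem coeff_congr_of_prod {q : ℕ} {x x' : Fin q → ℂ} {y y' : Fin (q + 1) → ℂ}
    (hx : ∀ f : ℂ → ℂ, ∏ i, f (x' i) = ∏ i, f (x i)) (hy : ∀ f : ℂ → ℂ, ∏ i, f (y' i) = ∏ i, f (y i))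
    (he : excess x' y' = excess x y) (n : ℕ) : coeff q x' y' n = coeff q x y n := by
  obtain ⟨R, hR⟩ := isInverseGammaSeries_coeff x' y'
  have : IsInverseGammaSeries x y (coeff q x' y') := by
    refine ⟨R, fun z hz => ?_⟩
    have := hR z hz
    rwa [he, hx fun t => Complex.Gamma (z + t), hy fun t => Complex.Gamma (z + t)] at this
  exact congrFun (this.unique (isInverseGammaSeries_coeff x y)) n

theorem coeff_comp_perm_left {q : ℕ} (x : Fin q → ℂ) (y : Fin (q + 1) → ℂ)
    (σ : Equiv.Perm (Fin q)) (n : ℕ) : coeff q (x ∘ σ) y n = coeff q x y n :=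
  coeff_congr_of_prod (fun f => Equiv.prod_comp σ fun i => f (x i)) (fun _ => rfl)
    (by rw [excess, excess]; exact congrArg _ (Equiv.sum_comp σ x)) n

theorem coeff_comp_perm_right {q : ℕ} (x : Fin q → ℂ) (y : Fin (q + 1) → ℂ)
    (τ : Equiv.Perm (Fin (q + 1))) (n : ℕ) : coeff q x (y ∘ τ) n = coeff q x y n :=
  coeff_congr_of_prod (fun _ => rfl) (fun f => Equiv.prod_comp τ fun i => f (y i))
    (by rw [excess, excess]; exact congrArg (· - _) (Equiv.sum_comp τ y)) n

theorem excess_snoc {q k : ℕ} (u : Fin q → ℂ) (a : ℂ) (y : Fin k → ℂ) :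
    excess (Fin.snoc u a : Fin (q + 1) → ℂ) y = excess u y - a := by
  rw [excess, excess, Fin.sum_snoc]
  ring

/-- Replacing a by the reflected value turns each of the two symbols of the last step into ± the
other, by `poch_reflect`; the signs agree and cancel, term by term in the recurrence. -/
theorem coeff_snoc_reflect {q : ℕ} (u : Fin q → ℂ) (a : ℂ) (y : Fin (q + 2) → ℂ) (m : ℕ) :
    coeff (q + 1) (Fin.snoc u a) y (m + 1) =
      coeff (q + 1) (Fin.snoc u (excess (Fin.snoc u a : Fin (q + 1) → ℂ) y + m)) y (m + 1) := by
  rw [coeff, coeff]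
  refine sum_congr rfl fun j hj => ?_
  have hjm : j ≤ m + 1 := Nat.lt_succ_iff.1 (mem_range.1 hj)
  simp only [Fin.snoc_last, Fin.init_snoc, excess_snoc]
  have hy : excess u y = excess u (Fin.init y : Fin (q + 1) → ℂ) + y (Fin.last (q + 1)) := by
    rw [excess, excess, Fin.sum_univ_castSucc]
    simp only [Fin.init]
    ring
  set e := excess u (Fin.init y : Fin (q + 1) → ℂ)
  set t := y (Fin.last (q + 1))
  have hk : ((m + 1 - j : ℕ) : ℂ) = m + 1 - j := by push_cast [Nat.cast_sub hjm]; rfl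
  have r1 := poch_reflect (e - a + j) (m + 1 - j)
  have r2 := poch_reflect (t - a) (m + 1 - j)
  rw [hk] at r1 r2
  rw [hy, show t - (e + t - a + m) = 1 - (e - a + j) - (m + 1 - j) by ring, r1,
    show e - (e + t - a + m) + j = 1 - (t - a) - (m + 1 - j) by ring, r2]
  linear_combination -(poch (t - a) (m + 1 - j) / ((m + 1 - j).factorial : ℂ) *
    poch (e - a + j) (m + 1 - j) * coeff q u (Fin.init y) j) * neg_one_pow_mul_self (m + 1 - j)

theorem coeff_reflect {q : ℕ} (x : Fin (q + 1) → ℂ) (y : Fin (q + 2) → ℂ) (m : ℕ)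
    (ω : Fin (q + 1)) :
    coeff (q + 1) x y (m + 1) =
      coeff (q + 1) (Fin.snoc (fun i : Fin q => x (ω.succAbove i)) (excess x y + m)) y (m + 1) := by
  have he : excess (Fin.snoc (fun i : Fin q => x (ω.succAbove i)) (x ω) : Fin (q + 1) → ℂ) y =
      excess x y := by
    rw [excess_snoc, excess, excess, Fin.sum_univ_succAbove x ω]
    ring
  rw [← he, ← coeff_snoc_reflect]
  refine (coeff_congr_of_prod (fun f => ?_) (fun _ => rfl) he (m + 1)).symm
  rw [Fin.prod_univ_castSucc, Fin.prod_univ_succAbove (fun i => f (x i)) ω, mul_comm]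
  simp

section nonneg

open scoped ComplexOrder

theorem poch_nonneg {a : ℂ} (h : 0 ≤ a) (k : ℕ) : 0 ≤ poch a k := by
  rw [poch_eq_prod]
  exact prod_nonneg fun i _ => add_nonneg h (Nat.cast_nonneg i)

theorem dpoch_nonneg {a : ℂ} (h : 0 ≤ a) (k : ℕ) : 0 ≤ dpoch a k := by
  rw [dpoch, div_eq_mul_inv, show ((k.factorial : ℂ))⁻¹ = (((k.factorial : ℝ)⁻¹ : ℝ) : ℂ) by simp]
  exact mul_nonneg (poch_nonneg h k) (Complex.zero_le_real.2 (by positivity))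

theorem chain_nonneg {w : ℕ → ℕ → ℕ → ℂ} {q : ℕ} (h : ∀ s < q, ∀ m n, 0 ≤ w s m n) (n : ℕ) :
    0 ≤ chain w q n := by
  induction q generalizing n with
  | zero =>
    rw [chain]
    split_ifs
    exacts [zero_le_one, le_rfl]
  | succ q ih =>
    rw [chain]
    exact sum_nonneg fun m _ => mul_nonneg (h q (by omega) m n) (ih (fun s hs => h s (by omega)) m)

theorem coeff_nonneg {r : ℕ} {x : Fin (r + 1) → ℂ} {y : Fin (r + 2) → ℂ}
    (h : ∀ m : ℕ, 1 ≤ m → m ≤ r + 1 → 0 ≤ nu x y m ∧ coord x m ≤ coord y (m + 1)) (n : ℕ) :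
    0 ≤ coeff (r + 1) x y n := by
  rw [coeff_eq_chain_coord]
  refine chain_nonneg (fun s hs m n => ?_) n
  obtain ⟨h1, h2⟩ := h (s + 1) (by omega) (by omega)
  rw [baseWeight, ← nu_succ_eq]
  exact mul_nonneg (dpoch_nonneg (sub_nonneg.2 h2) _)
    (poch_nonneg (add_nonneg h1 (Nat.cast_nonneg m)) _)

end nonneg

end Norlund

open Norlund in
open scoped ComplexOrder in
/-- Here `p = r + 2 ≥ 3`. For complex numbers `a ≤ b` means that `b - a` is a non-negative real
number. -/
theorem mainTheorem1 (r : ℕ) (hr : 1 ≤ r) (x : Fin (r + 1) → ℂ) (y : Fin (r + 2) → ℂ) :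
    -- the coefficients `g_n^p(x; y)` are those of the inverse gamma series
    IsInverseGammaSeries x y (coeff (r + 1) x y) ∧
    -- all the multiple hypergeometric series are equal to them
    (∀ n : ℕ, WellDefined n (firstDen x y n) → firstSeries x y n = coeff (r + 1) x y n) ∧
    (∀ n : ℕ, Odd (r + 2) → WellDefined n (oddDen x y n) →
      oddSeries x y n = coeff (r + 1) x y n) ∧
    (∀ n : ℕ, Even (r + 2) → WellDefined n (evenDen x y n) →
      evenSeries x y n = coeff (r + 1) x y n) ∧
    -- symmetry in the components of `x` and in those of `y`
    (∀ (n : ℕ) (σ : Equiv.Perm (Fin (r + 1))),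
      coeff (r + 1) (x ∘ σ) y n = coeff (r + 1) x y n) ∧
    (∀ (n : ℕ) (τ : Equiv.Perm (Fin (r + 2))),
      coeff (r + 1) x (y ∘ τ) n = coeff (r + 1) x y n) ∧
    -- the reflection formula
    (∀ (m : ℕ) (ω : Fin (r + 1)),
      coeff (r + 1) x y (m + 1) =
        coeff (r + 1) (Fin.snoc (fun i : Fin r => x (ω.succAbove i)) (excess x y + m)) y
          (m + 1)) ∧
    -- non-negativity
    ((∀ m : ℕ, 1 ≤ m → m ≤ r + 1 → 0 ≤ nu x y m ∧ coord x m ≤ coord y (m + 1)) →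
      ∀ n : ℕ, 0 ≤ coeff (r + 1) x y n) := by
  exact ⟨isInverseGammaSeries_coeff x y, firstSeries_eq x y, oddSeries_eq x y,
    evenSeries_eq hr x y, fun n σ => coeff_comp_perm_left x y σ n,
    fun n τ => coeff_comp_perm_right x y τ n,
    coeff_reflect x y, coeff_nonneg⟩
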